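/- Let $d\ge 2$, $n\ge 0$ and $s\ge 2$ be integers, and let $$\mathbb V_0^{d+1}=\{(x,t)\in\mathbb R^d\times\mathbb R:\ \|x\|=t,\ 0\le t\le 1\}$$ be the conic surface, whose points are written $(x,t)=(t\xi,t)$ with $\xi\in\mathbb S^{d-1}$. Let $$\mathcal D_{\gamma}=t(1-t)\frac{d^2}{dt^2}+\bigl(d-1-(d+\gamma)t\bigr)\frac{d}{dt}+t^{-1}\Delta_0^{(\xi)},$$ acting on functions of $(\xi,t)$, where $\Delta_0^{(\xi)}$ is the Laplace–Beltrami operator of $\mathbb S^{d-1}$. Let $\mathcal H_m^{d,0}$ be the space of homogeneous harmonic polynomials of degree $m$ in $x\in\mathbb R^d$. Let $\mathcal V_m^d(\mathsf w_{\beta,\gamma})$ be the space of orthogonal polynomials of degree $m$ on $\mathbb V_0^{d+1}$, that is, the restrictions to $\mathbb V_0^{d+1}$ of polynomials of degree at most $m$ in $(x,t)$ that are orthogonal to all polynomials of degree less than $m$ with respect to $$\langle f,g\rangle_{\beta,\gamma}=\int_0^1 t^{d-1}\int_{\mathbb S^{d-1}} f(t\xi,t)\,g(t\xi,t)\,d\sigma(\xi)\;t^{\beta}(1-t)^{\gamma}\,dt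 .$$ Spaces with a negative index $m$ are zero. Let $$P_j^{(\alpha,\beta)}(z)=\frac1{j!}\sum_{k=0}^{j}\binom jk (j+\alpha+\beta+1)_k\,(\alpha+k+1)_{j-k}\Bigl(\frac{z-1}{2}\Bigr)^k$$ be the Jacobi polynomials with arbitrary real parameters. Define $\mathcal U_n^d(\mathsf w_{-1,-s})$ as the linear span, in the space of functions on $\mathbb V_0^{d+1}$, of $$\mathcal H_n^{d,0},\qquad P_j^{(2n-2j+d-2,\,-s)}(1-2t)\,\mathcal H_{n-j}^{d,0}\quad (1\le j\le s-1),\qquad (1-t)^s\,\mathcal V_{n-s}^d(\mathsf w_{-1,s}).$$ **Theorem.** Every $Z\in\mathcal U_n^d(\mathsf w_{-1,-s})$ satisfies, for $\xi\in\mathbb S^{d-1}$ and $0<t\le 1$, $$\mathcal D_{-s}Z=-n(n-s+d-1)\,Z .$$ Moreover, if for every $j$ with $1\le j\le \min(s-1,n)$ the integer $-2n-d+j+s+2$ is not between $1$ and $j$ (inclusive), i.e. if none of the Jacobi polynomials $P_j^{(2n-2j+d-2,-s)}$ involved has a degree reduction, then $\mathcal U_n^d(\mathsf w_{-1,-s})$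 has full dimension: $$\dim\mathcal U_n^d(\mathsf w_{-1,-s})=\binom{n+d-1}{d-1}+\binom{n+d-2}{d-1},$$ which is the dimension of the space of orthogonal polynomials of degree $n$ on $\mathbb V_0^{d+1}$. -/

import Mathlib

noncomputable section

namespace ConicSurface

/-- The Euclidean space `ℝ^d`. -/
abbrev E (d : ℕ) : Type := EuclideanSpace ℝ (Fin d)

/-- The conic surface `V₀^{d+1} = {(x,t) : ‖x‖ = t, 0 ≤ t ≤ 1}` in `ℝ^d × ℝ`. -/
def V0 (d : ℕ) : Set (E d × ℝ) := {p | ‖p.1‖ = p.2 ∧ 0 ≤ p.2 ∧ p.2 ≤ 1}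

open Classical in
/-- A function `f` on the conic surface in the coordinates `(x,t) = (t ξ, t)`, that is
`(ξ, t) ↦ f (t ξ, t)` for `ξ` in the unit sphere and `0 ≤ t ≤ 1`
(with the irrelevant value `0` where `(t ξ, t)` is not on the surface). -/
def polar {d : ℕ} (f : V0 d → ℝ) (ξ : E d) (t : ℝ) : ℝ :=
  if h : ((t • ξ, t) : E d × ℝ) ∈ V0 d then f ⟨(t • ξ, t), h⟩ else 0

/-- The Laplace–Beltrami operator `Δ₀` of the unit sphere: the Laplacian of the extension of `g`
that is homogeneous of degree zero, evaluated at a point `ξ` of the sphere. Only the values of `g`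
on the unit sphere are used. -/
def laplaceBeltrami {d : ℕ} (g : E d → ℝ) (ξ : E d) : ℝ :=
  (Laplacian.laplacian (fun x : E d => g (‖x‖⁻¹ • x)) : E d → ℝ) ξ

/-- The operator
`D_γ = t (1-t) d²/dt² + (d - 1 - (d+γ) t) d/dt + t⁻¹ Δ₀^{(ξ)}`
acting on a function on the conic surface written in the coordinates `(ξ, t)`; its value
at the point `(t ξ, t)`, for `ξ` in the unit sphere and `0 < t ≤ 1`. The derivatives in `t` are
derivatives within the interval `[0,1]` (one-sided at `t = 1`). -/
def diffOp {d : ℕ} (γ : ℝ) (f : V0 d → ℝ) (ξ : E d) (t : ℝ) : ℝ :=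
  t * (1 - t) * iteratedDerivWithin 2 (fun τ => polar f ξ τ) (Set.Icc 0 1) t
    + ((d : ℝ) - 1 - ((d : ℝ) + γ) * t) * derivWithin (fun τ => polar f ξ τ) (Set.Icc 0 1) t
    + t⁻¹ * laplaceBeltrami (fun η => polar f η t) ξ

/-- The space `H_m^{d,0}` of solid harmonics: homogeneous polynomials of degree `m` in `d`
variables that are annihilated by the Laplace operator. -/
def solidHarmonics (d m : ℕ) : Set (MvPolynomial (Fin d) ℝ) :=
  {Y | Y.IsHomogeneous m ∧ ∑ i, MvPolynomial.pderiv i (MvPolynomial.pderiv i Y) = 0}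

/-- The function `(x,t) ↦ p(t) Y(x)` on the conic surface. -/
def mulHarmonic {d : ℕ} (p : ℝ → ℝ) (Y : MvPolynomial (Fin d) ℝ) : V0 d → ℝ :=
  fun z => p z.1.2 * MvPolynomial.eval (fun i => z.1.1 i) Y

/-- The Jacobi polynomial `P_n^{(α,β)}` for arbitrary real parameters:
`P_n^{(α,β)}(x) = (1/n!) ∑_k binom(n,k) (n+α+β+1)_k (α+k+1)_{n-k} ((x-1)/2)^k`,
which is `((α+1)_n / n!) ₂F₁(-n, n+α+β+1; α+1; (1-x)/2)` with the denominators `(α+1)_k`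
cancelled. -/
def jacobiP (n : ℕ) (α β x : ℝ) : ℝ :=
  (n.factorial : ℝ)⁻¹ * ∑ k ∈ Finset.range (n + 1),
    (n.choose k : ℝ) * (ascPochhammer ℝ k).eval ((n : ℝ) + α + β + 1)
      * (ascPochhammer ℝ (n - k)).eval (α + (k : ℝ) + 1) * ((x - 1) / 2) ^ k

/-- Restrictions to the conic surface of polynomials in `(x,t)` of total degree at most `k`. -/
def conePoly (d k : ℕ) : Set (V0 d → ℝ) :=
  {f | ∃ q : MvPolynomial (Fin d ⊕ Unit) ℝ, q.totalDegree ≤ k ∧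
    ∀ z : V0 d, f z = MvPolynomial.eval (Sum.elim (fun i => z.1.1 i) (fun _ => z.1.2)) q}

/-- The inner product
`⟨f, g⟩_{β,γ} = ∫_{V₀} f g t^β (1-t)^γ dm`, where
`∫_{V₀} F dm = ∫₀¹ t^{d-1} ∫_{S^{d-1}} F(t ξ, t) dσ(ξ) dt` and `σ` is the surface measure.
The positive normalization constant in front is dropped: it does not affect orthogonality. -/
def coneInner {d : ℕ} (β γ : ℝ) (f g : V0 d → ℝ) : ℝ :=
  ∫ t in (0 : ℝ)..1, t ^ (d - 1) *
    (∫ ξ : Metric.sphere (0 : E d) 1,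
      polar f (ξ : E d) t * polar g (ξ : E d) t
        ∂((MeasureTheory.volume : MeasureTheory.Measure (E d)).toSphere))
    * (t ^ β * (1 - t) ^ γ)

/-- The space `V_n^d(w_{β,γ})` of orthogonal polynomials of degree `n` on the conic surface:
polynomials of degree at most `n` that are orthogonal to all polynomials of lower degree. -/
def orthPoly (d n : ℕ) (β γ : ℝ) : Set (V0 d → ℝ) :=
  {f | f ∈ conePoly d n ∧ ∀ k < n, ∀ g ∈ conePoly d k, coneInner β γ f g = 0}

/-- The space `U_n^d(w_{-1,-s})`: the linear span of `H_n^{d,0}`, of the products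
`P_j^{(2n-2j+d-2,-s)}(1-2t) H_{n-j}^{d,0}` for `1 ≤ j ≤ s-1` and of `(1-t)^s V_{n-s}^d(w_{-1,s})`.
Spaces with a negative index are zero, so only `j ≤ n` occur, and the last part
occurs only for `s ≤ n`. -/
def spaceU (d n s : ℕ) : Submodule ℝ (V0 d → ℝ) :=
  Submodule.span ℝ
    ({f | ∃ Y ∈ solidHarmonics d n, f = mulHarmonic (fun _ => 1) Y}
      ∪ {f | ∃ j : ℕ, 1 ≤ j ∧ j ≤ s - 1 ∧ j ≤ n ∧ ∃ Y ∈ solidHarmonics d (n - j),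
          f = mulHarmonic
            (fun t => jacobiP j (2 * (n : ℝ) - 2 * (j : ℝ) + (d : ℝ) - 2) (-(s : ℝ)) (1 - 2 * t)) Y}
      ∪ {f | s ≤ n ∧ ∃ g ∈ orthPoly d (n - s) (-1) (s : ℝ),
          f = fun z => (1 - z.1.2) ^ s * g z})

end ConicSurface

end

/-!
The space `U_n` is the sum of the spaces `P_{n-k}^{(2k+d-2,-s)}(1-2t) H_k` over all harmonic
degrees `k ≤ n`. For `n - k < s` these are the defining summands; for `n - k ≥ s` they form
`(1-t)^s V_{n-s}(w_{-1,s})`, because `P_{j+s}^{(α,-s)}(1-2t)` is a nonzero multiple of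
`(1-t)^s P_j^{(α,s)}(1-2t)`: both solve the same Jacobi equation, and for `α > -1` a polynomial
solution is determined by its value at `t = 0`, where neither of them vanishes. In the same way
`V_m(w_{β,γ})` is the sum of the `P_{m-k}^{(2k+d-1+β,γ)}(1-2t) H_k`, by orthogonality of harmonics
of different degrees on the sphere and of Jacobi polynomials on `[0,1]`.

On `t^k p(t) Y(ξ)` with `Y ∈ H_k` the operator `D_γ` acts through the Jacobi operator on `p`,
with an eigenvalue that does not depend on `k` when `p = P_{n-k}^{(2k+d-2,γ)}(1-2t)`. The sum over
`k` is direct since harmonics of different degrees are independent on the sphere, so that its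
dimension is `∑_{k ≤ n} dim H_k` as soon as no Jacobi factor is zero; a drop in their degrees does
no harm.
-/

noncomputable section

namespace ConicSurface

/-! ### Harmonic polynomials -/

section HarmonicPolynomials

open MvPolynomial

variable (σ K : Type*) [Fintype σ] [Field K]

/-- The Laplace operator `∑ i, ∂ᵢ²` on polynomials. -/
def polyLaplacian : MvPolynomial σ K →ₗ[K] MvPolynomial σ K :=
  ∑ i, (pderiv i).toLinearMap ∘ₗ (pderiv i).toLinearMap

/-- The polynomial `∑ i, Xᵢ²`, which is `‖x‖²` on Euclidean space. -/
def normSqPoly : MvPolynomial σ K := ∑ i, X i ^ 2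

/-- The space `H_k` of solid harmonics of degree `k`, as a subspace of the polynomials over any
field; over `ℝ` it is the set `solidHarmonics`. -/
def harmonicSubmodule (k : ℕ) : Submodule K (MvPolynomial σ K) :=
  homogeneousSubmodule σ K k ⊓ LinearMap.ker (polyLaplacian σ K)

variable {σ K} {k : ℕ} {p q : MvPolynomial σ K}

lemma polyLaplacian_apply (p : MvPolynomial σ K) :
    polyLaplacian σ K p = ∑ i, pderiv i (pderiv i p) := by
  simp [polyLaplacian]

lemma mem_harmonicSubmodule :
    p ∈ harmonicSubmodule σ K k ↔ p.IsHomogeneous k ∧ polyLaplacian σ K p = 0 :=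
  Iff.rfl

lemma coe_harmonicSubmodule (d k : ℕ) :
    (harmonicSubmodule (Fin d) ℝ k : Set (MvPolynomial (Fin d) ℝ)) = solidHarmonics d k := by
  ext p
  simp [mem_harmonicSubmodule, solidHarmonics, polyLaplacian_apply]

instance finite_homogeneousSubmodule {τ R : Type*} [Finite τ] [CommSemiring R] (k : ℕ) :
    Module.Finite R (homogeneousSubmodule τ R k) :=
  Module.Finite.iff_fg.mpr (homogeneousSubmodule_fg τ R k)

instance finite_harmonicSubmodule (k : ℕ) : Module.Finite K (harmonicSubmodule σ K k) :=
  Submodule.finiteDimensional_of_le inf_le_left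

lemma isHomogeneous_normSqPoly : (normSqPoly σ K).IsHomogeneous 2 :=
  IsHomogeneous.sum _ _ _ fun i _ => isHomogeneous_X_pow i 2

lemma isHomogeneous_normSqPoly_mul (hp : p.IsHomogeneous k) :
    (normSqPoly σ K * p).IsHomogeneous (k + 2) := by
  simpa only [add_comm] using isHomogeneous_normSqPoly.mul hp

lemma isHomogeneous_polyLaplacian (hp : p.IsHomogeneous k) :
    (polyLaplacian σ K p).IsHomogeneous (k - 2) := by
  rw [polyLaplacian_apply]
  exact IsHomogeneous.sum _ _ _ fun i _ => hp.pderiv.pderiv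

lemma polyLaplacian_eq_zero_of_lt_two (hk : k < 2) (hp : p.IsHomogeneous k) :
    polyLaplacian σ K p = 0 := by
  rw [polyLaplacian_apply]
  refine Finset.sum_eq_zero fun i _ => ?_
  have h0 : (pderiv i p).IsHomogeneous 0 := by simpa [show k - 1 = 0 by lia] using hp.pderiv
  rw [← totalDegree_zero_iff_isHomogeneous, totalDegree_eq_zero_iff_eq_C] at h0
  rw [h0, pderiv_C]

lemma pderiv_normSqPoly (i : σ) : pderiv i (normSqPoly σ K) = 2 * X i := by
  classical
  simp [normSqPoly, Pi.single_apply]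

lemma polyLaplacian_normSqPoly_mul (hp : p.IsHomogeneous k) :
    polyLaplacian σ K (normSqPoly σ K * p)
      = (2 * Fintype.card σ + 4 * k : ℕ) • p + normSqPoly σ K * polyLaplacian σ K p := by
  have hterm (i : σ) : pderiv i (pderiv i (normSqPoly σ K * p))
      = 2 * p + 4 * (X i * pderiv i p) + normSqPoly σ K * pderiv i (pderiv i p) := by
    have h2 : pderiv i (2 : MvPolynomial σ K) = 0 := (pderiv i).map_natCast 2
    simp only [pderiv_mul, map_add, pderiv_normSqPoly, pderiv_X_self, h2]
    ring
  rw [polyLaplacian_apply, Finset.sum_congr rfl fun i _ => hterm i, Finset.sum_add_distrib,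
    Finset.sum_add_distrib, ← Finset.mul_sum, ← Finset.mul_sum, ← Finset.mul_sum,
    hp.sum_X_mul_pderiv, polyLaplacian_apply]
  simp only [Finset.sum_const, Finset.card_univ, nsmul_eq_mul]
  push_cast
  ring

lemma finrank_homogeneousSubmodule (k : ℕ) :
    Module.finrank K (homogeneousSubmodule σ K k) = (Fintype.card σ + k - 1).choose k := by
  classical
  have hset : {a : σ →₀ ℕ | a.degree = k}
      = ((Finset.univ : Finset σ).finsuppAntidiag k : Set (σ →₀ ℕ)) := by
    ext a
    simp [Finset.mem_finsuppAntidiag, Finsupp.degree_eq_sum]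
  have hsub : homogeneousSubmodule σ K k = restrictSupport K {a : σ →₀ ℕ | a.degree = k} :=
    homogeneousSubmodule_eq_finsupp_supported σ K k
  rw [hsub, hset, Module.finrank_eq_nat_card_basis (basisRestrictSupport K _),
    Nat.card_coe_set_eq, Set.ncard_coe_finset, Finset.card_finsuppAntidiag_nat_eq_choose,
    Finset.card_univ]

lemma harmonicSubmodule_of_lt_two (hk : k < 2) :
    harmonicSubmodule σ K k = homogeneousSubmodule σ K k :=
  inf_eq_left.mpr fun _ hp => polyLaplacian_eq_zero_of_lt_two hk hp

variable [CharZero K]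

lemma eq_zero_of_normSqPoly_mul_polyLaplacian_eq {c : ℕ} (hc : c ≠ 0) (hp : p.IsHomogeneous k)
    (h : normSqPoly σ K * polyLaplacian σ K p = -(c • p)) : p = 0 := by
  induction k using Nat.strong_induction_on generalizing c p with
  | _ k ih =>
    rcases lt_or_ge k 2 with hk | hk
    · rw [polyLaplacian_eq_zero_of_lt_two hk hp, mul_zero, eq_comm, neg_eq_zero] at h
      exact (smul_eq_zero.mp h).resolve_left hc
    obtain ⟨r, hr⟩ : ∃ r, r = -((c : K)⁻¹ • polyLaplacian σ K p) := ⟨_, rfl⟩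
    have hc' : (c : K) ≠ 0 := Nat.cast_ne_zero.mpr hc
    have hLap : polyLaplacian σ K p = -(c • r) := by
      rw [hr, smul_neg, neg_neg, ← Nat.cast_smul_eq_nsmul K, smul_inv_smul₀ hc']
    have hpr : p = normSqPoly σ K * r := by
      rw [hr, mul_neg, mul_smul_comm, h, smul_neg, neg_neg, ← Nat.cast_smul_eq_nsmul K,
        inv_smul_smul₀ hc']
    have hrhom : r.IsHomogeneous (k - 2) := by
      rw [hr]
      exact neg_mem (Submodule.smul_mem (homogeneousSubmodule σ K (k - 2)) _
        (isHomogeneous_polyLaplacian hp))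
    have hr0 : r = 0 := by
      refine ih (k - 2) (by lia) (c := c + (2 * Fintype.card σ + 4 * (k - 2))) (by lia)
        hrhom ?_
      have h' := polyLaplacian_normSqPoly_mul hrhom
      rw [← hpr, hLap] at h'
      rw [add_smul, neg_add, h']
      abel
    rw [hpr, hr0, mul_zero]

section Nonempty

variable [Nonempty σ]

lemma eq_zero_of_polyLaplacian_normSqPoly_mul_eq_zero (hp : p.IsHomogeneous k)
    (h : polyLaplacian σ K (normSqPoly σ K * p) = 0) : p = 0 := by
  have hcard : 0 < Fintype.card σ := Fintype.card_pos
  rw [polyLaplacian_normSqPoly_mul hp, add_comm] at h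
  exact eq_zero_of_normSqPoly_mul_polyLaplacian_eq (by lia) hp (eq_neg_of_add_eq_zero_left h)

lemma exists_polyLaplacian_normSqPoly_mul_eq (hp : p.IsHomogeneous k) :
    ∃ q : MvPolynomial σ K, q.IsHomogeneous k ∧ polyLaplacian σ K (normSqPoly σ K * q) = p := by
  let T : homogeneousSubmodule σ K k →ₗ[K] homogeneousSubmodule σ K k :=
    (polyLaplacian σ K ∘ₗ LinearMap.mulLeft K (normSqPoly σ K)).restrict fun q hq =>
      isHomogeneous_polyLaplacian (isHomogeneous_normSqPoly_mul hq)
  have hT : Function.Injective T := (injective_iff_map_eq_zero T).mpr fun q hq =>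
    Subtype.ext (eq_zero_of_polyLaplacian_normSqPoly_mul_eq_zero q.2 (congrArg Subtype.val hq))
  obtain ⟨q, hq⟩ := LinearMap.surjective_of_injective hT ⟨p, hp⟩
  exact ⟨q, q.2, congrArg Subtype.val hq⟩

lemma exists_harmonic_add_normSqPoly_mul (hp : p.IsHomogeneous (k + 2)) :
    ∃ Y ∈ harmonicSubmodule σ K (k + 2), ∃ q : MvPolynomial σ K, q.IsHomogeneous k ∧
      p = Y + normSqPoly σ K * q := by
  obtain ⟨q, hq, hLap⟩ := exists_polyLaplacian_normSqPoly_mul_eq (isHomogeneous_polyLaplacian hp)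
  refine ⟨p - normSqPoly σ K * q, mem_harmonicSubmodule.mpr ⟨?_, ?_⟩, q, hq, by ring⟩
  · exact hp.sub (isHomogeneous_normSqPoly_mul hq)
  · rw [map_sub, hLap, sub_self]

lemma finrank_harmonicSubmodule_add (k : ℕ) :
    Module.finrank K (harmonicSubmodule σ K (k + 2))
      + Module.finrank K (homogeneousSubmodule σ K k)
      = Module.finrank K (homogeneousSubmodule σ K (k + 2)) := by
  let T : homogeneousSubmodule σ K (k + 2) →ₗ[K] homogeneousSubmodule σ K k :=
    (polyLaplacian σ K).restrict fun q hq => isHomogeneous_polyLaplacian hq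
  have hsurj : LinearMap.range T = ⊤ := LinearMap.range_eq_top.mpr fun p => by
    obtain ⟨q, hq, hLap⟩ := exists_polyLaplacian_normSqPoly_mul_eq p.2
    exact ⟨⟨_, isHomogeneous_normSqPoly_mul hq⟩, Subtype.ext hLap⟩
  have hker : (LinearMap.ker T).map (Submodule.subtype _) = harmonicSubmodule σ K (k + 2) := by
    ext p
    constructor
    · rintro ⟨⟨q, hq⟩, h0, rfl⟩
      exact ⟨hq, congrArg Subtype.val h0⟩
    · rintro ⟨hp, h0⟩
      exact ⟨⟨p, hp⟩, Subtype.ext h0, rfl⟩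
  rw [← hker, Submodule.finrank_map_subtype_eq, add_comm, ← T.finrank_range_add_finrank_ker,
    hsurj, finrank_top]

lemma sum_finrank_harmonicSubmodule (n : ℕ) :
    ∑ k ∈ Finset.range (n + 2), Module.finrank K (harmonicSubmodule σ K k)
      = Module.finrank K (homogeneousSubmodule σ K (n + 1))
        + Module.finrank K (homogeneousSubmodule σ K n) := by
  induction n with
  | zero =>
    rw [Finset.sum_range_succ, Finset.sum_range_one, harmonicSubmodule_of_lt_two two_pos,
      harmonicSubmodule_of_lt_two one_lt_two, zero_add, add_comm]
  | succ n ih =>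
    rw [Finset.sum_range_succ, ih, ← finrank_harmonicSubmodule_add n]
    ring

end Nonempty

lemma sum_finrank_harmonicSubmodule_eq_choose [Nontrivial σ] (n : ℕ) :
    ∑ k ∈ Finset.range (n + 1), Module.finrank K (harmonicSubmodule σ K k)
      = (n + Fintype.card σ - 1).choose (Fintype.card σ - 1)
        + (n + Fintype.card σ - 2).choose (Fintype.card σ - 1) := by
  obtain ⟨e, he⟩ := Nat.exists_eq_add_of_le' (Fintype.one_lt_card (α := σ))
  rcases n with _ | n
  · rw [Finset.sum_range_one, harmonicSubmodule_of_lt_two two_pos, finrank_homogeneousSubmodule]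
    simp [he]
  · rw [sum_finrank_harmonicSubmodule, finrank_homogeneousSubmodule, finrank_homogeneousSubmodule,
      he, show e + 2 + (n + 1) - 1 = n + 1 + (e + 1) by lia,
      show e + 2 + n - 1 = n + (e + 1) by lia, show n + 1 + (e + 2) - 1 = n + 1 + (e + 1) by lia,
      show n + 1 + (e + 2) - 2 = n + (e + 1) by lia, show e + 2 - 1 = e + 1 by lia,
      Nat.choose_symm_add, Nat.choose_symm_add]

end HarmonicPolynomials

/-! ### Integration of polynomials over the unit sphere -/

section SphereIntegral

open MeasureTheory Set MvPolynomial

lemma eval_smul_of_isHomogeneous {σ R : Type*} [CommSemiring R] {k : ℕ} {p : MvPolynomial σ R}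
    (hp : p.IsHomogeneous k) (r : R) (x : σ → R) : eval (r • x) p = r ^ k * eval x p := by
  rw [eval_eq, eval_eq, Finset.mul_sum]
  refine Finset.sum_congr rfl fun a ha => ?_
  simp only [Pi.smul_apply, smul_eq_mul, mul_pow, Finset.prod_mul_distrib,
    Finset.prod_pow_eq_pow_sum, ← hp.degree_eq_sum_deg_support ha]
  ring

lemma integral_mul_norm_eq_integral_sphere_mul {F : Type*} [NormedAddCommGroup F]
    [NormedSpace ℝ F] [FiniteDimensional ℝ F] [Nontrivial F] [MeasurableSpace F] [BorelSpace F]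
    (μ : Measure F) [μ.IsAddHaarMeasure] {f : F → ℝ} {k : ℕ}
    (hf : ∀ (r : ℝ) x, f (r • x) = r ^ k * f x) (g : ℝ → ℝ) :
    ∫ x, f x * g ‖x‖ ∂μ
      = (∫ ξ : Metric.sphere (0 : F) 1, f ξ ∂μ.toSphere)
        * ∫ r in Ioi (0 : ℝ), r ^ (Module.finrank ℝ F - 1) * (r ^ k * g r) := by
  set N := Module.finrank ℝ F - 1
  calc
    _ = ∫ x : ({0}ᶜ : Set F), f x * g ‖x.1‖ ∂(μ.comap (↑)) := by
      rw [integral_subtype_comap (measurableSet_singleton _).compl fun x => f x * g ‖x‖,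
        restrict_compl_singleton]
    _ = ∫ z : Metric.sphere (0 : F) 1 × Ioi (0 : ℝ), f z.1 * ((z.2 : ℝ) ^ k * g z.2)
          ∂μ.toSphere.prod (.volumeIoiPow N) := by
      rw [← μ.measurePreserving_homeomorphUnitSphereProd.integral_comp
        (Homeomorph.measurableEmbedding _)]
      refine integral_congr_ae (Filter.Eventually.of_forall fun x => ?_)
      have hx : ‖x.1‖ ≠ 0 := norm_ne_zero_iff.mpr x.2
      simp only [homeomorphUnitSphereProd_apply_snd_coe, homeomorphUnitSphereProd_apply_fst_coe]
      rw [hf, inv_pow, ← mul_assoc, mul_right_comm _ (f _), inv_mul_cancel₀ (pow_ne_zero k hx),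
        one_mul]
    _ = (∫ ξ : Metric.sphere (0 : F) 1, f ξ ∂μ.toSphere)
          * ∫ r : Ioi (0 : ℝ), (r : ℝ) ^ k * g r ∂.volumeIoiPow N :=
      integral_prod_mul (fun ξ : Metric.sphere (0 : F) 1 => f ξ)
        (fun r : Ioi (0 : ℝ) => (r : ℝ) ^ k * g r)
    _ = _ := by
      simp only [Measure.volumeIoiPow, ENNReal.ofReal]
      rw [integral_withDensity_eq_integral_smul
          (measurable_subtype_coe.pow_const N).real_toNNReal,
        integral_subtype_comap measurableSet_Ioi fun r : ℝ =>
          Real.toNNReal (r ^ N) • (r ^ k * g r),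
        setIntegral_congr_fun measurableSet_Ioi fun r hr => ?_]
      rw [NNReal.smul_def, Real.coe_toNNReal _ (pow_nonneg hr.out.le _), smul_eq_mul]

lemma continuous_eval_ofLp {ι : Type*} (p : MvPolynomial ι ℝ) :
    Continuous fun x : EuclideanSpace ℝ ι => eval x.ofLp p :=
  (continuous_eval p).comp (PiLp.continuous_ofLp 2 _)

variable {ι : Type*} [Fintype ι]

lemma hasFDerivAt_eval (p : MvPolynomial ι ℝ) (x : EuclideanSpace ℝ ι) :
    HasFDerivAt (fun y : EuclideanSpace ℝ ι => eval y.ofLp p)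
      (∑ i, eval x.ofLp (pderiv i p) • (EuclideanSpace.proj i : EuclideanSpace ℝ ι →L[ℝ] ℝ)) x := by
  classical
  induction p using MvPolynomial.induction_on with
  | C c => simpa using hasFDerivAt_const c x
  | add p q hp hq =>
    simpa only [map_add, add_smul, Finset.sum_add_distrib] using! hp.add hq
  | mul_X p i hp =>
    have hX : HasFDerivAt (fun y : EuclideanSpace ℝ ι => y.ofLp i)
        ((EuclideanSpace.proj i : EuclideanSpace ℝ ι →L[ℝ] ℝ)) x :=
      (EuclideanSpace.proj i : EuclideanSpace ℝ ι →L[ℝ] ℝ).hasFDerivAt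
    simp only [map_mul, eval_X]
    convert! hp.mul hX using 1
    simp [add_smul, Finset.sum_add_distrib, Finset.smul_sum, smul_smul, Pi.single_apply,
      apply_ite (eval x.ofLp), add_comm]

lemma fderiv_eval_single {κ : Type*} [Finite κ] [DecidableEq κ] (p : MvPolynomial κ ℝ)
    (x : EuclideanSpace ℝ κ) (i : κ) :
    fderiv ℝ (fun y : EuclideanSpace ℝ κ => eval y.ofLp p) x (EuclideanSpace.single i 1)
      = eval x.ofLp (pderiv i p) := by
  have := Fintype.ofFinite κ
  rw [(hasFDerivAt_eval p x).fderiv]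
  simp [_root_.sum_apply]

lemma integrable_pow_mul_exp_neg_sq (k : ℕ) :
    Integrable fun x : ℝ => x ^ k * Real.exp (-x ^ 2) := by
  simpa using integrable_rpow_mul_exp_neg_mul_sq one_pos
    (s := (k : ℝ)) (by linarith [Nat.cast_nonneg (α := ℝ) k])

lemma integrable_eval_mul_exp_neg_norm_sq (p : MvPolynomial ι ℝ) :
    Integrable fun x : EuclideanSpace ℝ ι => eval x.ofLp p * Real.exp (-‖x‖ ^ 2) := by
  induction p using MvPolynomial.induction_on' with
  | monomial a c =>
    rw [← (PiLp.volume_preserving_toLp ι).integrable_comp_emb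
      (MeasurableEquiv.toLp 2 _).measurableEmbedding]
    have hprod := (Integrable.fintype_prod (f := fun i (x : ℝ) => x ^ a i * Real.exp (-x ^ 2))
      fun i => integrable_pow_mul_exp_neg_sq (a i)).const_mul c
    refine hprod.congr (Filter.Eventually.of_forall fun x => ?_)
    simp only [Function.comp_apply, EuclideanSpace.norm_sq_eq, Real.norm_eq_abs, sq_abs]
    rw [eval_monomial, Finset.prod_mul_distrib, ← Real.exp_sum, Finset.sum_neg_distrib,
      Finsupp.prod_fintype _ _ (by simp), mul_assoc]
  | add p q hp hq =>
    simpa only [map_add, add_mul] using! hp.add hq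

lemma integral_pderiv_mul_exp_neg_norm_sq (i : ι) (p : MvPolynomial ι ℝ) :
    ∫ x : EuclideanSpace ℝ ι, eval x.ofLp (pderiv i p) * Real.exp (-‖x‖ ^ 2)
      = 2 * ∫ x : EuclideanSpace ℝ ι, eval x.ofLp (X i * p) * Real.exp (-‖x‖ ^ 2) := by
  classical
  let g : EuclideanSpace ℝ ι → ℝ := fun x => Real.exp (-‖x‖ ^ 2)
  have hg (x : EuclideanSpace ℝ ι) :
      HasFDerivAt g (Real.exp (-‖x‖ ^ 2) • (-(2 • innerSL ℝ x) : EuclideanSpace ℝ ι →L[ℝ] ℝ)) x :=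
    (hasStrictFDerivAt_norm_sq x).hasFDerivAt.neg.exp
  have hfg' (x : EuclideanSpace ℝ ι) :
      eval x.ofLp p * fderiv ℝ g x (EuclideanSpace.single i 1)
        = -2 * (eval x.ofLp (X i * p) * Real.exp (-‖x‖ ^ 2)) := by
    rw [(hg x).fderiv]
    simp [EuclideanSpace.inner_single_right]
    ring
  have hibp := integral_mul_fderiv_eq_neg_fderiv_mul_of_integrable (μ := volume)
    (f := fun x : EuclideanSpace ℝ ι => eval x.ofLp p) (g := g) (v := EuclideanSpace.single i 1)
    (by simpa only [fderiv_eval_single] using integrable_eval_mul_exp_neg_norm_sq (pderiv i p))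
    (by simpa only [hfg'] using (integrable_eval_mul_exp_neg_norm_sq (X i * p)).const_mul (-2))
    (integrable_eval_mul_exp_neg_norm_sq p)
    (fun x _ => (hasFDerivAt_eval p x).differentiableAt)
    (fun x _ => (hg x).differentiableAt)
  simp only [hfg', fderiv_eval_single, integral_const_mul] at hibp
  linarith

/-- The Gaussian integral `p ↦ ∫ p(x) exp(-‖x‖²) dx`, through which orthogonality on the sphere
becomes integration by parts on the whole space. -/
def gaussianIntegral (ι : Type*) [Fintype ι] : MvPolynomial ι ℝ →ₗ[ℝ] ℝ where
  toFun p := ∫ x : EuclideanSpace ℝ ι, eval x.ofLp p * Real.exp (-‖x‖ ^ 2)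
  map_add' p q := by
    simp only [map_add, add_mul]
    exact integral_add (integrable_eval_mul_exp_neg_norm_sq p)
      (integrable_eval_mul_exp_neg_norm_sq q)
  map_smul' c p := by simp [smul_eval, mul_assoc, integral_const_mul]

lemma gaussianIntegral_pderiv (i : ι) (p : MvPolynomial ι ℝ) :
    gaussianIntegral ι (pderiv i p) = 2 * gaussianIntegral ι (X i * p) :=
  integral_pderiv_mul_exp_neg_norm_sq i p

/-- The integral of a polynomial over the unit sphere with respect to surface measure. -/
def sphereIntegral (ι : Type*) [Fintype ι] : MvPolynomial ι ℝ →ₗ[ℝ] ℝ where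
  toFun p := ∫ ξ : Metric.sphere (0 : EuclideanSpace ℝ ι) 1, eval (ξ : EuclideanSpace ℝ ι).ofLp p
    ∂(volume : Measure (EuclideanSpace ℝ ι)).toSphere
  map_add' p q := by
    have hint (r : MvPolynomial ι ℝ) :=
      ((continuous_eval_ofLp r).comp continuous_subtype_val).integrable_of_hasCompactSupport
        (μ := (volume : Measure (EuclideanSpace ℝ ι)).toSphere)
        (HasCompactSupport.of_compactSpace (α := Metric.sphere (0 : EuclideanSpace ℝ ι) 1) _)
    simp only [map_add]
    exact integral_add (hint p) (hint q)
  map_smul' c p := by simp [smul_eval, integral_const_mul]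

lemma sphereIntegral_apply (p : MvPolynomial ι ℝ) :
    sphereIntegral ι p = ∫ ξ : Metric.sphere (0 : EuclideanSpace ℝ ι) 1,
      eval (ξ : EuclideanSpace ℝ ι).ofLp p ∂(volume : Measure (EuclideanSpace ℝ ι)).toSphere :=
  rfl

lemma gaussianIntegral_grad_mul_grad {k : ℕ} {p q : MvPolynomial ι ℝ}
    (hq : q ∈ harmonicSubmodule ι ℝ k) :
    gaussianIntegral ι (∑ i, pderiv i p * pderiv i q) = 2 * k * gaussianIntegral ι (p * q) := by
  have hdiv : ∑ i, pderiv i (p * pderiv i q) = ∑ i, pderiv i p * pderiv i q := by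
    simp only [pderiv_mul, Finset.sum_add_distrib, ← Finset.mul_sum]
    rw [← polyLaplacian_apply, (mem_harmonicSubmodule.mp hq).2, mul_zero, add_zero]
  have heuler : ∑ i, X i * (p * pderiv i q) = k • (p * q) := by
    simp only [mul_left_comm _ p, ← Finset.mul_sum, IsHomogeneous.sum_X_mul_pderiv hq.1,
      mul_smul_comm]
  rw [← hdiv, map_sum]
  simp only [gaussianIntegral_pderiv]
  rw [← Finset.mul_sum, ← map_sum, heuler, map_nsmul, nsmul_eq_mul, mul_assoc]

lemma gaussianIntegral_mul_eq_zero_of_harmonic {k l : ℕ} (hkl : k ≠ l) {p q : MvPolynomial ι ℝ}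
    (hp : p ∈ harmonicSubmodule ι ℝ k) (hq : q ∈ harmonicSubmodule ι ℝ l) :
    gaussianIntegral ι (p * q) = 0 := by
  have hpq := gaussianIntegral_grad_mul_grad (p := p) hq
  have hqp := gaussianIntegral_grad_mul_grad (p := q) hp
  simp_rw [mul_comm (pderiv _ q), mul_comm q p] at hqp
  have hkl' : (k : ℝ) - l ≠ 0 := sub_ne_zero.mpr (by exact_mod_cast hkl)
  exact (mul_eq_zero.mp (by linarith : ((k : ℝ) - l) * _ = 0)).resolve_left hkl'

lemma setIntegral_Ioi_pow_mul_exp_neg_sq_pos (k : ℕ) :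
    0 < ∫ r in Ioi (0 : ℝ), r ^ k * Real.exp (-r ^ 2) := by
  have hpos : ∀ r ∈ Ioi (0 : ℝ), 0 < r ^ k * Real.exp (-r ^ 2) := fun r hr =>
    mul_pos (pow_pos hr k) (Real.exp_pos _)
  have hsupp : Ioi (0 : ℝ) ⊆ Function.support fun r => r ^ k * Real.exp (-r ^ 2) :=
    fun r hr => (hpos r hr).ne'
  rw [setIntegral_pos_iff_support_of_nonneg_ae
    ((ae_restrict_mem measurableSet_Ioi).mono fun r hr => (hpos r hr).le)
    (integrable_pow_mul_exp_neg_sq k).integrableOn,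
    inter_eq_right.mpr hsupp]
  simp

lemma sphereIntegral_mul_eq_zero_of_harmonic [Nonempty ι] {k l : ℕ} (hkl : k ≠ l)
    {p q : MvPolynomial ι ℝ} (hp : p ∈ harmonicSubmodule ι ℝ k)
    (hq : q ∈ harmonicSubmodule ι ℝ l) : sphereIntegral ι (p * q) = 0 := by
  have hpolar := integral_mul_norm_eq_integral_sphere_mul
    (volume : Measure (EuclideanSpace ℝ ι)) (f := fun x => eval x.ofLp (p * q))
    (fun r x => eval_smul_of_isHomogeneous (IsHomogeneous.mul hp.1 hq.1) r x.ofLp)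
    fun r => Real.exp (-r ^ 2)
  rw [show ∫ x : EuclideanSpace ℝ ι, eval x.ofLp (p * q) * Real.exp (-‖x‖ ^ 2) = 0 from
    gaussianIntegral_mul_eq_zero_of_harmonic hkl hp hq] at hpolar
  simp_rw [← mul_assoc, ← pow_add] at hpolar
  exact (mul_eq_zero.mp hpolar.symm).resolve_right
    (setIntegral_Ioi_pow_mul_exp_neg_sq_pos _).ne'

lemma eval_eq_zero_of_sphereIntegral_mul_self_eq_zero {p : MvPolynomial ι ℝ}
    (h : sphereIntegral ι (p * p) = 0) {ξ : EuclideanSpace ℝ ι}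
    (hξ : ξ ∈ Metric.sphere (0 : EuclideanSpace ℝ ι) 1) : eval ξ.ofLp p = 0 := by
  have hcont : Continuous fun ξ : Metric.sphere (0 : EuclideanSpace ℝ ι) 1 =>
      eval (ξ : EuclideanSpace ℝ ι).ofLp (p * p) :=
    (continuous_eval_ofLp (p * p)).comp continuous_subtype_val
  by_contra hp
  refine (hcont.integral_pos_of_hasCompactSupport_nonneg_nonzero
    (HasCompactSupport.of_compactSpace _) (fun η => ?_) (x := ⟨ξ, hξ⟩) ?_).ne' h
  · simpa only [map_mul] using! mul_self_nonneg _
  · simpa only [map_mul] using mul_self_ne_zero.mpr hp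

variable [Nonempty ι]

lemma eq_zero_of_isHomogeneous_of_eval_sphere_eq_zero {k : ℕ} {p : MvPolynomial ι ℝ}
    (hp : p.IsHomogeneous k)
    (h : ∀ ξ ∈ Metric.sphere (0 : EuclideanSpace ℝ ι) 1, eval ξ.ofLp p = 0) : p = 0 := by
  refine MvPolynomial.funext fun x => ?_
  obtain ⟨r, ξ, hξ, hx⟩ : ∃ (r : ℝ) (ξ : EuclideanSpace ℝ ι), ξ ∈ Metric.sphere 0 1 ∧
      r • ξ = WithLp.toLp 2 x := by
    rcases eq_or_ne (WithLp.toLp 2 x) 0 with hx | hx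
    · obtain ⟨ξ, hξ⟩ := (NormedSpace.sphere_nonempty (x := (0 : EuclideanSpace ℝ ι))).mpr
        zero_le_one
      exact ⟨0, ξ, hξ, by rw [zero_smul, hx]⟩
    · refine ⟨‖WithLp.toLp 2 x‖, ‖WithLp.toLp 2 x‖⁻¹ • WithLp.toLp 2 x, ?_, ?_⟩
      · simp [norm_smul, norm_ne_zero_iff.mpr hx]
      · rw [smul_inv_smul₀ (norm_ne_zero_iff.mpr hx)]
  rw [← WithLp.ofLp_toLp 2 x, ← hx, WithLp.ofLp_smul, eval_smul_of_isHomogeneous hp, h ξ hξ,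
    mul_zero, map_zero]

lemma eq_zero_of_sum_harmonic_eval_sphere_eq_zero {κ : Type*} [Fintype κ] {deg : κ → ℕ}
    (hdeg : Function.Injective deg) {Y : κ → MvPolynomial ι ℝ}
    (hY : ∀ k, Y k ∈ harmonicSubmodule ι ℝ (deg k))
    (h : ∀ ξ ∈ Metric.sphere (0 : EuclideanSpace ℝ ι) 1, eval ξ.ofLp (∑ k, Y k) = 0) (l : κ) :
    Y l = 0 := by
  have hsum : sphereIntegral ι (∑ k, Y k * Y l) = 0 := by
    rw [← Finset.sum_mul, sphereIntegral_apply]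
    simp only [map_mul, h _ (Subtype.prop _), zero_mul, integral_zero]
  rw [map_sum, Finset.sum_eq_single l (fun k _ hkl =>
    sphereIntegral_mul_eq_zero_of_harmonic (hdeg.ne hkl) (hY k) (hY l)) (by simp)] at hsum
  exact eq_zero_of_isHomogeneous_of_eval_sphere_eq_zero (hY l).1 fun ξ hξ =>
    eval_eq_zero_of_sphereIntegral_mul_self_eq_zero hsum hξ

end SphereIntegral

/-! ### Jacobi polynomials as eigenfunctions -/

section JacobiPolynomials

open MeasureTheory Set Polynomial

/-- The Jacobi operator `t (1-t) p'' + (α + 1 - (α + β + 2) t) p'` in the variable `t` of `[0,1]`,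
where the Jacobi polynomials are evaluated at `1 - 2t`. -/
def jacobiOp (α β : ℝ) (p : ℝ[X]) : ℝ[X] :=
  X * (1 - X) * derivative (derivative p) + (C (α + 1) - C (α + β + 2) * X) * derivative p

/-- The Jacobi polynomial `t ↦ P_j^{(α,β)}(1 - 2t)`. -/
def jacobiPoly (j : ℕ) (α β : ℝ) : ℝ[X] :=
  C (j.factorial : ℝ)⁻¹ * ∑ k ∈ Finset.range (j + 1),
    C ((-1) ^ k * ((j.choose k : ℝ) * (ascPochhammer ℝ k).eval ((j : ℝ) + α + β + 1)
      * (ascPochhammer ℝ (j - k)).eval (α + (k : ℝ) + 1))) * X ^ k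

lemma coeff_jacobiOp (α β : ℝ) (p : ℝ[X]) (k : ℕ) :
    (jacobiOp α β p).coeff k
      = (k + 1) * (k + α + 1) * p.coeff (k + 1) - k * (k + α + β + 1) * p.coeff k := by
  have h : jacobiOp α β p = X * derivative (derivative p) - X * (X * derivative (derivative p))
      + C (α + 1) * derivative p - C (α + β + 2) * (X * derivative p) := by
    rw [jacobiOp]
    ring
  rw [h]
  rcases k with _ | _ | k <;>
  · simp only [coeff_add, coeff_sub, coeff_C_mul, coeff_X_mul, coeff_X_mul_zero, coeff_derivative]
    push_cast
    ring

lemma jacobiOp_C_mul (α β c : ℝ) (p : ℝ[X]) : jacobiOp α β (C c * p) = C c * jacobiOp α β p := by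
  simp only [jacobiOp, derivative_C_mul]
  ring

lemma jacobiOp_sub (α β : ℝ) (p q : ℝ[X]) :
    jacobiOp α β (p - q) = jacobiOp α β p - jacobiOp α β q := by
  simp only [jacobiOp, derivative_sub]
  ring

lemma X_mul_derivative_mul_X_pow (p : ℝ[X]) (m : ℕ) :
    X * derivative (p * X ^ m) = (X * derivative p + C (m : ℝ) * p) * X ^ m := by
  rcases m with _ | m
  · simp
  · simp only [derivative_mul, derivative_X_pow, Nat.add_sub_cancel]
    ring

-- Both sides are expressed through `X * derivative`, which acts on `p X^m` as `X * derivative + m`.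
lemma X_mul_jacobiOp_mul_X_pow (α β : ℝ) (p : ℝ[X]) (m : ℕ) :
    X * jacobiOp α β (p * X ^ m) = (X * jacobiOp (α + 2 * m) β p + C (m * (m + α)) * p
      - C (m * (m + α + β + 1)) * (X * p)) * X ^ m := by
  have hX : ∀ (α : ℝ) (q : ℝ[X]), X * jacobiOp α β q = X * derivative (X * derivative q)
      + C α * (X * derivative q)
      - X * (X * derivative (X * derivative q) + C (α + β + 1) * (X * derivative q)) := by
    intro α q
    simp only [jacobiOp, derivative_mul, derivative_X, map_add, map_one, map_ofNat]
    ring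
  have htwice : X * derivative (X * derivative (p * X ^ m))
      = (X * derivative (X * derivative p + C (m : ℝ) * p)
        + C (m : ℝ) * (X * derivative p + C (m : ℝ) * p)) * X ^ m := by
    rw [X_mul_derivative_mul_X_pow, X_mul_derivative_mul_X_pow]
  rw [hX, hX, htwice, X_mul_derivative_mul_X_pow]
  simp only [derivative_C_mul, map_add, map_mul, map_one, map_ofNat]
  ring

lemma eval_jacobiPoly (j : ℕ) (α β t : ℝ) :
    (jacobiPoly j α β).eval t = jacobiP j α β (1 - 2 * t) := by
  simp only [jacobiPoly, jacobiP, eval_mul, eval_C, eval_finsetSum, eval_pow, eval_X]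
  congr 1
  refine Finset.sum_congr rfl fun k _ => ?_
  rw [show (1 - 2 * t - 1) / 2 = -1 * t by ring, mul_pow]
  ring

lemma jacobiPoly_zero (α β : ℝ) : jacobiPoly 0 α β = 1 := by
  simp [jacobiPoly]

lemma coeff_jacobiPoly (j : ℕ) (α β : ℝ) (k : ℕ) :
    (jacobiPoly j α β).coeff k = (j.factorial : ℝ)⁻¹ * ((-1) ^ k *
      ((j.choose k : ℝ) * (ascPochhammer ℝ k).eval ((j : ℝ) + α + β + 1)
      * (ascPochhammer ℝ (j - k)).eval (α + (k : ℝ) + 1))) := by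
  simp only [jacobiPoly, coeff_C_mul, finsetSum_coeff, coeff_X_pow, mul_ite, mul_one, mul_zero,
    Finset.sum_ite_eq, Finset.mem_range]
  split_ifs with hk
  · rfl
  · simp [Nat.choose_eq_zero_of_lt (by lia : j < k)]

lemma natDegree_jacobiPoly_le (j : ℕ) (α β : ℝ) : (jacobiPoly j α β).natDegree ≤ j :=
  natDegree_le_iff_coeff_eq_zero.mpr fun k hk => by
    simp [coeff_jacobiPoly, Nat.choose_eq_zero_of_lt hk]

lemma coeff_jacobiPoly_zero_ne_zero (j : ℕ) {α : ℝ} (hα : -1 < α) (β : ℝ) :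
    (jacobiPoly j α β).coeff 0 ≠ 0 := by
  have hpos := ascPochhammer_pos j (α + 1) (by linarith)
  simp [coeff_jacobiPoly, Nat.factorial_ne_zero, hpos.ne']

lemma coeff_jacobiPoly_self_ne_zero (j : ℕ) {α β : ℝ} (hα : -1 < α) (hβ : -1 < β) :
    (jacobiPoly j α β).coeff j ≠ 0 := by
  rcases j with _ | j
  · exact coeff_jacobiPoly_zero_ne_zero 0 hα β
  · have hpos := ascPochhammer_pos (j + 1) ((j + 1 : ℕ) + α + β + 1)
      (by push_cast; linarith [Nat.cast_nonneg (α := ℝ) j])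
    rw [coeff_jacobiPoly, Nat.choose_self, Nat.sub_self]
    simpa [Nat.factorial_ne_zero] using hpos.ne'

lemma jacobiOp_jacobiPoly (j : ℕ) (α β : ℝ) :
    jacobiOp α β (jacobiPoly j α β) = -(C (j * (j + α + β + 1)) * jacobiPoly j α β) := by
  ext k
  rw [coeff_neg, coeff_C_mul, coeff_jacobiOp, coeff_jacobiPoly, coeff_jacobiPoly]
  rcases lt_or_ge k j with hk | hk
  · obtain ⟨m, rfl⟩ := Nat.exists_eq_add_of_lt hk
    have hchoose : (((k + m + 1).choose (k + 1) : ℕ) : ℝ) * (k + 1)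
        = ((k + m + 1).choose k : ℕ) * (m + 1) := by
      have := Nat.choose_succ_right_eq (k + m + 1) k
      rw [show k + m + 1 - k = m + 1 by lia] at this
      exact_mod_cast this
    rw [show k + m + 1 - (k + 1) = m by lia, show k + m + 1 - k = m + 1 by lia,
      ascPochhammer_succ_eval, ascPochhammer_succ_left]
    simp only [eval_mul, eval_X, eval_comp, eval_add, eval_one]
    push_cast
    rw [show α + ((k : ℝ) + 1) + 1 = α + k + 1 + 1 by ring, pow_succ]
    generalize (ascPochhammer ℝ k).eval _ = A
    generalize (ascPochhammer ℝ m).eval _ = B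
    linear_combination (-(((k + m + 1).factorial : ℝ)⁻¹ * (-1) ^ k * A * B * (k + α + 1)
      * (k + m + 1 + α + β + 1 + k))) * hchoose
  · rw [Nat.choose_eq_zero_of_lt (Nat.lt_succ_of_le hk)]
    rcases hk.eq_or_lt with rfl | hk
    · push_cast
      ring
    · rw [Nat.choose_eq_zero_of_lt hk]
      push_cast
      ring

/- At the regular singular point `0` the exponents of the equation are `0` and `-α`, so that no
nonzero polynomial solution vanishes there. -/
lemma eq_zero_of_jacobiOp_eq_C_mul {α β lam : ℝ} (hα : -1 < α) {p : ℝ[X]}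
    (hp : jacobiOp α β p = C lam * p) (h0 : p.coeff 0 = 0) : p = 0 := by
  ext k
  induction k with
  | zero => exact h0
  | succ k ih =>
    have hk := congrArg (coeff · k) hp
    simp only [coeff_jacobiOp, coeff_C_mul, ih, coeff_zero, mul_zero, sub_zero] at hk ⊢
    have hpos : (0 : ℝ) < (k + 1) * (k + α + 1) :=
      mul_pos k.cast_add_one_pos (by linarith [Nat.cast_nonneg (α := ℝ) k])
    exact (mul_eq_zero.mp hk).resolve_left hpos.ne'

lemma one_sub_X_mul_derivative_one_sub_X_pow (s : ℕ) :
    (1 - X) * derivative ((1 - X) ^ s : ℝ[X]) = -(C (s : ℝ) * (1 - X) ^ s) := by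
  rcases s with _ | s
  · simp
  · rw [derivative_pow, Nat.add_sub_cancel, derivative_sub, derivative_one, derivative_X]
    ring

lemma jacobiOp_one_sub_X_pow_mul {α lam : ℝ} (s : ℕ) {p : ℝ[X]}
    (hp : jacobiOp α s p = C lam * p) :
    jacobiOp α (-s) ((1 - X) ^ s * p) = C (lam - s * (α + 1)) * ((1 - X) ^ s * p) := by
  have hw := one_sub_X_mul_derivative_one_sub_X_pow s
  have hw' := congrArg derivative hw
  set w : ℝ[X] := (1 - X) ^ s
  simp only [jacobiOp, derivative_mul, derivative_one, derivative_X,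
    derivative_C, map_add, map_sub, map_mul, map_neg, map_ofNat, C_1] at hp hw' ⊢
  linear_combination w * hp + X * p * hw' + (2 * X * derivative p + (C α + 1) * p) * hw

lemma exists_jacobiPoly_neg_eq {α : ℝ} (hα : -1 < α) (j s : ℕ) :
    ∃ c : ℝ, c ≠ 0 ∧ jacobiPoly (j + s) α (-s) = C c * ((1 - X) ^ s * jacobiPoly j α s) := by
  set p := jacobiPoly (j + s) α (-s)
  set q := (1 - X) ^ s * jacobiPoly j α s with hq
  set lam : ℝ := -((j + s : ℕ) * ((j + s : ℕ) + α + -s + 1))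
  have hp_eigen : jacobiOp α (-s) p = C lam * p := by
    rw [jacobiOp_jacobiPoly, C_neg, neg_mul]
  have hq_eigen : jacobiOp α (-s) q = C lam * q := by
    rw [jacobiOp_one_sub_X_pow_mul (lam := -(j * (j + α + s + 1))) s
      (by rw [jacobiOp_jacobiPoly, C_neg, neg_mul])]
    congr 2
    push_cast [lam]
    ring
  have hp0 : p.coeff 0 ≠ 0 := coeff_jacobiPoly_zero_ne_zero _ hα _
  have hq0 : q.coeff 0 ≠ 0 := by
    simpa [hq, coeff_zero_eq_eval_zero] using coeff_jacobiPoly_zero_ne_zero j hα s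
  refine ⟨p.coeff 0 / q.coeff 0, div_ne_zero hp0 hq0, sub_eq_zero.mp
    (eq_zero_of_jacobiOp_eq_C_mul (β := -s) (lam := lam) hα ?_ ?_)⟩
  · rw [jacobiOp_sub, jacobiOp_C_mul, hp_eigen, hq_eigen]
    ring
  · simp [hq0]

/-! ### Orthogonality of Jacobi polynomials -/

lemma intervalIntegrable_rpow_mul_one_sub_rpow {α β : ℝ} (hα : -1 < α) (hβ : -1 < β) :
    IntervalIntegrable (fun t : ℝ => t ^ α * (1 - t) ^ β) volume 0 1 := by
  have hbeta := (intervalIntegrable_iff_integrableOn_Ioc_of_le zero_le_one).mp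
    (Complex.betaIntegral_convergent (u := (α + 1 : ℝ)) (v := (β + 1 : ℝ))
      (by simpa using by linarith) (by simpa using by linarith))
  refine (intervalIntegrable_iff_integrableOn_Ioc_of_le zero_le_one).mpr
    (IntegrableOn.congr_fun hbeta.re (fun t ht => ?_) measurableSet_Ioc)
  have hcast : ((t : ℂ) ^ (((α + 1 : ℝ) : ℂ) - 1) * (1 - (t : ℂ)) ^ (((β + 1 : ℝ) : ℂ) - 1))
      = ((t ^ α * (1 - t) ^ β : ℝ) : ℂ) := by
    rw [Complex.ofReal_mul, Complex.ofReal_cpow ht.1.le, Complex.ofReal_cpow (sub_nonneg.mpr ht.2)]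
    push_cast
    simp only [add_sub_cancel_right]
  simp only [hcast, RCLike.re_to_complex, Complex.ofReal_re]

lemma eqOn_zero_of_integral_mul_rpow_mul_one_sub_rpow_eq_zero {α β : ℝ} (hα : -1 < α)
    (hβ : -1 < β) {φ : ℝ → ℝ} (hφ : ContinuousOn φ (Icc 0 1)) (hφ0 : ∀ t ∈ Icc (0 : ℝ) 1, 0 ≤ φ t)
    (h : ∫ t in (0 : ℝ)..1, φ t * (t ^ α * (1 - t) ^ β) = 0) : EqOn φ 0 (Icc 0 1) := by
  have hint : IntervalIntegrable (fun t => φ t * (t ^ α * (1 - t) ^ β)) volume 0 1 :=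
    (intervalIntegrable_rpow_mul_one_sub_rpow hα hβ).continuousOn_mul
      (by rwa [uIcc_of_le zero_le_one])
  have hnonneg : 0 ≤ᵐ[volume.restrict (Ioc 0 1)] fun t => φ t * (t ^ α * (1 - t) ^ β) :=
    (ae_restrict_mem measurableSet_Ioc).mono fun t ht =>
      mul_nonneg (hφ0 t (Ioc_subset_Icc_self ht)) (mul_nonneg (Real.rpow_nonneg ht.1.le _)
        (Real.rpow_nonneg (sub_nonneg.mpr ht.2) _))
  rw [intervalIntegral.integral_eq_zero_iff_of_le_of_nonneg_ae zero_le_one hnonneg hint,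
    ← restrict_Ioo_eq_restrict_Ioc] at h
  refine Measure.eqOn_Icc_of_ae_eq volume zero_ne_one ?_ hφ continuousOn_const
  rw [← restrict_Ioo_eq_restrict_Icc]
  filter_upwards [h, ae_restrict_mem measurableSet_Ioo] with t ht0 ht
  exact (mul_eq_zero.mp ht0).resolve_right
    (mul_pos (Real.rpow_pos_of_pos ht.1 _) (Real.rpow_pos_of_pos (sub_pos.mpr ht.2) _)).ne'

/-- Integration over `[0,1]` against the Jacobi weight `t^α (1-t)^β`. -/
def jacobiIntegral {α β : ℝ} (hα : -1 < α) (hβ : -1 < β) : ℝ[X] →ₗ[ℝ] ℝ where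
  toFun p := ∫ t in (0 : ℝ)..1, p.eval t * (t ^ α * (1 - t) ^ β)
  map_add' p q := by
    have hint (r : ℝ[X]) := (intervalIntegrable_rpow_mul_one_sub_rpow hα hβ).continuousOn_mul
      r.continuousOn
    simp only [eval_add, add_mul]
    exact intervalIntegral.integral_add (hint p) (hint q)
  map_smul' c p := by simp [mul_assoc]

lemma jacobiIntegral_apply {α β : ℝ} (hα : -1 < α) (hβ : -1 < β) (p : ℝ[X]) :
    jacobiIntegral hα hβ p = ∫ t in (0 : ℝ)..1, p.eval t * (t ^ α * (1 - t) ^ β) :=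
  rfl

lemma hasDerivAt_rpow_mul_one_sub_rpow_mul_eval {α β t : ℝ} (ht : t ∈ Ioo (0 : ℝ) 1) (p : ℝ[X]) :
    HasDerivAt (fun t : ℝ => t ^ (α + 1) * (1 - t) ^ (β + 1) * p.eval t)
      ((X * (1 - X) * derivative p + (C (α + 1) - C (α + β + 2) * X) * p).eval t
        * (t ^ α * (1 - t) ^ β)) t := by
  have h0 : 0 < t := ht.1
  have h1 : 0 < 1 - t := sub_pos.mpr ht.2
  have hrpow := Real.hasDerivAt_rpow_const (x := t) (p := α + 1) (Or.inl h0.ne')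
  have hrpow' := (Real.hasDerivAt_rpow_const (x := 1 - t) (p := β + 1) (Or.inl h1.ne')).comp t
    ((hasDerivAt_id t).const_sub 1)
  convert! (hrpow.mul hrpow').mul (p.hasDerivAt t) using 1
  simp only [eval_add, eval_mul, eval_sub, eval_X, eval_one, eval_C, add_sub_cancel_right,
    Pi.mul_apply, Function.comp_apply, Real.rpow_add_one h0.ne', Real.rpow_add_one h1.ne']
  ring

lemma jacobiIntegral_jacobiOp_mul {α β : ℝ} (hα : -1 < α) (hβ : -1 < β) (p q : ℝ[X]) :
    jacobiIntegral hα hβ (jacobiOp α β p * q) = jacobiIntegral hα hβ (p * jacobiOp α β q) := by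
  -- `t^α (1-t)^β (p Lq - q Lp)` is the derivative of `t^(α+1) (1-t)^(β+1)` times the Wronskian.
  set w := derivative p * q - p * derivative q with hw
  have hdiff : jacobiOp α β p * q - p * jacobiOp α β q
      = X * (1 - X) * derivative w + (C (α + 1) - C (α + β + 2) * X) * w := by
    simp only [hw, jacobiOp, derivative_mul, derivative_sub]
    ring
  have hα' : 0 < α + 1 := by linarith
  have hβ' : 0 < β + 1 := by linarith
  have hcont : Continuous fun t : ℝ => t ^ (α + 1) * (1 - t) ^ (β + 1) * w.eval t :=
    ((Real.continuous_rpow_const hα'.le).mul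
      ((Real.continuous_rpow_const hβ'.le).comp (continuous_const.sub continuous_id))).mul
      w.continuous
  have hftc := intervalIntegral.integral_eq_sub_of_hasDerivAt_of_le zero_le_one hcont.continuousOn
    (fun t ht => hasDerivAt_rpow_mul_one_sub_rpow_mul_eval (α := α) (β := β) ht w)
    ((intervalIntegrable_rpow_mul_one_sub_rpow hα hβ).continuousOn_mul
      (Polynomial.continuousOn _))
  rw [← sub_eq_zero, ← map_sub, hdiff, jacobiIntegral_apply, hftc]
  simp [Real.zero_rpow hα'.ne', Real.zero_rpow hβ'.ne']

lemma jacobiOp_X_pow (α β : ℝ) (i : ℕ) :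
    jacobiOp α β (X ^ i)
      = C (i * (i + α)) * X ^ (i - 1) - C (i * (i + α + β + 1)) * X ^ i := by
  ext k
  simp only [coeff_jacobiOp, coeff_sub, coeff_C_mul, coeff_X_pow]
  rcases i with _ | i
  · rcases k with _ | k <;> simp
  · rcases lt_trichotomy k i with h | rfl | h
    · simp [h.ne, (by lia : k ≠ i + 1)]
    · simp [add_right_comm]
    · by_cases hk : k = i + 1 <;> simp [hk, h.ne']

lemma jacobiIntegral_jacobiPoly_mul_X_pow {α β : ℝ} (hα : -1 < α) (hβ : -1 < β) {i j : ℕ}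
    (hij : i < j) : jacobiIntegral hα hβ (jacobiPoly j α β * X ^ i) = 0 := by
  have hrec (i : ℕ) : (j - i : ℝ) * (j + i + α + β + 1)
        * jacobiIntegral hα hβ (jacobiPoly j α β * X ^ i)
      = -(i * (i + α) * jacobiIntegral hα hβ (jacobiPoly j α β * X ^ (i - 1))) := by
    have hsymm := jacobiIntegral_jacobiOp_mul hα hβ (jacobiPoly j α β) (X ^ i)
    rw [jacobiOp_jacobiPoly, jacobiOp_X_pow, neg_mul, mul_assoc, mul_sub, mul_left_comm _ (C _),
      mul_left_comm _ (C _), map_neg, map_sub] at hsymm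
    simp only [← smul_eq_C_mul, map_smul, smul_eq_mul] at hsymm
    linear_combination -hsymm
  induction i with
  | zero =>
    have hj : (1 : ℝ) ≤ j := by exact_mod_cast hij
    have h0 := hrec 0
    simp only [Nat.cast_zero, zero_mul, neg_zero] at h0
    exact (mul_eq_zero.mp h0).resolve_left
      (mul_pos (by linarith) (by linarith) : (0 : ℝ) < (j - 0) * (j + 0 + α + β + 1)).ne'
  | succ i ih =>
    have hj : ((i + 1 : ℕ) : ℝ) + 1 ≤ j := by exact_mod_cast hij
    have hi1 := hrec (i + 1)
    rw [Nat.add_sub_cancel, ih (by lia), mul_zero, neg_zero] at hi1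
    exact (mul_eq_zero.mp hi1).resolve_left
      (mul_pos (by linarith) (by linarith [Nat.cast_nonneg (α := ℝ) (i + 1)])).ne'

lemma jacobiIntegral_jacobiPoly_mul {α β : ℝ} (hα : -1 < α) (hβ : -1 < β) {j : ℕ} {p : ℝ[X]}
    (hp : p ∈ degreeLT ℝ j) : jacobiIntegral hα hβ (jacobiPoly j α β * p) = 0 := by
  rw [degreeLT_eq_span_X_pow] at hp
  induction hp using Submodule.span_induction with
  | mem p hp =>
    obtain ⟨i, hi, rfl⟩ := Finset.mem_image.mp (Finset.mem_coe.mp hp)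
    exact jacobiIntegral_jacobiPoly_mul_X_pow hα hβ (Finset.mem_range.mp hi)
  | zero => simp
  | add p q _ _ hp hq => rw [mul_add, map_add, hp, hq, add_zero]
  | smul c p _ hp => rw [mul_smul_comm, map_smul, hp, smul_zero]

end JacobiPolynomials

/-! ### Polynomials on the conic surface -/

section ConePolynomials

open MvPolynomial

open Polynomial (degreeLT)

/-- The bilinear map sending `p` and `Y` to the function `(x, t) ↦ p(t) Y(x)` on the conic
surface. -/
def radialMul (d : ℕ) : Polynomial ℝ →ₗ[ℝ] MvPolynomial (Fin d) ℝ →ₗ[ℝ] (V0 d → ℝ) :=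
  LinearMap.mk₂ ℝ (fun p Y => mulHarmonic (fun t => p.eval t) Y)
    (fun p q Y => by ext z; simp [mulHarmonic, add_mul])
    (fun c p Y => by ext z; simp [mulHarmonic, mul_assoc])
    (fun p Y Z => by ext z; simp [mulHarmonic, mul_add])
    (fun c p Y => by ext z; simp [mulHarmonic, mul_left_comm])

/-- Restriction to the conic surface of polynomials in `(x, t)`. -/
def coneRestrict (d : ℕ) : MvPolynomial (Fin d ⊕ Unit) ℝ →ₗ[ℝ] (V0 d → ℝ) where
  toFun q z := eval (Sum.elim (fun i => z.1.1 i) fun _ => z.1.2) q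
  map_add' p q := by ext z; simp
  map_smul' c q := by ext z; simp [smul_eval]

/-- The space of restrictions to the conic surface of polynomials of degree at most `m`. -/
def conePolySubmodule (d m : ℕ) : Submodule ℝ (V0 d → ℝ) :=
  (restrictTotalDegree (Fin d ⊕ Unit) ℝ m).map (coneRestrict d)

/-- The space spanned by the functions `p(t) Y(x)` with `Y` a solid harmonic and
`deg p + deg Y < m`. -/
def coneSpan (d m : ℕ) : Submodule ℝ (V0 d → ℝ) :=
  ⨆ k, Submodule.map₂ (radialMul d) (degreeLT ℝ (m - k)) (harmonicSubmodule (Fin d) ℝ k)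

variable {d : ℕ}

lemma radialMul_apply (p : Polynomial ℝ) (Y : MvPolynomial (Fin d) ℝ) (z : V0 d) :
    radialMul d p Y z = p.eval z.1.2 * eval z.1.1.ofLp Y := rfl

lemma coneRestrict_apply (q : MvPolynomial (Fin d ⊕ Unit) ℝ) (z : V0 d) :
    coneRestrict d q z = eval (Sum.elim (fun i => z.1.1 i) fun _ => z.1.2) q := rfl

lemma coe_conePolySubmodule (d m : ℕ) :
    (conePolySubmodule d m : Set (V0 d → ℝ)) = conePoly d m := by
  ext f
  simp only [conePolySubmodule, Submodule.map_coe, Set.mem_image, SetLike.mem_coe,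
    mem_restrictTotalDegree, conePoly, Set.mem_ofPred_eq, funext_iff, eq_comm (b := f _),
    coneRestrict_apply]

lemma continuous_coneRestrict (q : MvPolynomial (Fin d ⊕ Unit) ℝ) :
    Continuous (coneRestrict d q) := by
  refine (continuous_eval q).comp (continuous_pi fun i => ?_)
  rcases i with i | i <;> simp only [Sum.elim_inl, Sum.elim_inr] <;> fun_prop

lemma continuous_of_mem_conePoly {m : ℕ} {f : V0 d → ℝ} (hf : f ∈ conePoly d m) :
    Continuous f := by
  rw [← coe_conePolySubmodule] at hf
  obtain ⟨q, -, rfl⟩ := hf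
  exact continuous_coneRestrict q

lemma coneRestrict_monomial (a : Fin d ⊕ Unit →₀ ℕ) (c : ℝ) :
    coneRestrict d (monomial a c)
      = radialMul d (Polynomial.X ^ a (Sum.inr ()))
        (monomial (a.comapDomain Sum.inl Sum.inl_injective.injOn) c) := by
  ext z
  rw [coneRestrict_apply, radialMul_apply, eval_monomial, eval_monomial,
    Finsupp.prod_fintype _ _ (by simp), Finsupp.prod_fintype _ _ (by simp),
    Fintype.prod_sum_type]
  simp only [Sum.elim_inl, Finset.univ_unique, PUnit.default_eq_unit, Sum.elim_inr,
    Finset.prod_singleton, Finsupp.comapDomain_apply, Polynomial.eval_pow, Polynomial.eval_X]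
  ring

lemma radialMul_mem_coneSpan {k m : ℕ} {p : Polynomial ℝ} (hp : p ∈ degreeLT ℝ (m - k))
    {Y : MvPolynomial (Fin d) ℝ} (hY : Y ∈ harmonicSubmodule (Fin d) ℝ k) :
    radialMul d p Y ∈ coneSpan d m :=
  Submodule.mem_iSup_of_mem k (Submodule.apply_mem_map₂ _ hp hY)

lemma radialMul_X_pow_mem_conePolySubmodule {i k m : ℕ} (him : i + k ≤ m)
    {p : MvPolynomial (Fin d) ℝ} (hp : p.IsHomogeneous k) :
    radialMul d (Polynomial.X ^ i) p ∈ conePolySubmodule d m := by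
  refine ⟨X (Sum.inr ()) ^ i * rename Sum.inl p, ?_, ?_⟩
  · refine (mem_restrictTotalDegree ..).mpr ((totalDegree_mul _ _).trans (le_trans ?_ him))
    rw [totalDegree_X_pow]
    exact Nat.add_le_add_left ((totalDegree_rename_le _ _).trans hp.totalDegree_le) i
  · ext z
    rw [coneRestrict_apply, radialMul_apply, map_mul, eval_rename]
    simp [Function.comp_def]

lemma coneSpan_succ_le_conePolySubmodule (d m : ℕ) :
    coneSpan d (m + 1) ≤ conePolySubmodule d m := by
  refine iSup_le fun k => Submodule.map₂_le.mpr fun p hp Y hY => ?_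
  suffices hle : degreeLT ℝ (m + 1 - k)
      ≤ (conePolySubmodule d m).comap ((radialMul d).flip Y) from hle hp
  rw [Polynomial.degreeLT_eq_span_X_pow, Submodule.span_le]
  intro q hq
  obtain ⟨i, hi, rfl⟩ := Finset.mem_image.mp (Finset.mem_coe.mp hq)
  have hik := Finset.mem_range.mp hi
  exact radialMul_X_pow_mem_conePolySubmodule (by lia : i + k ≤ m) hY.1

variable [NeZero d]

/- On the cone `‖x‖² = t²`, so the harmonic decomposition of `p` only costs powers of `t`. -/
lemma radialMul_X_pow_mem_coneSpan {i k m : ℕ} (him : i + k < m) {p : MvPolynomial (Fin d) ℝ}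
    (hp : p.IsHomogeneous k) : radialMul d (Polynomial.X ^ i) p ∈ coneSpan d m := by
  have hX {i k : ℕ} (hik : i + k < m) : (Polynomial.X ^ i : Polynomial ℝ) ∈ degreeLT ℝ (m - k) :=
    Polynomial.mem_degreeLT.mpr (by rw [Polynomial.degree_X_pow]; exact_mod_cast by lia)
  induction k using Nat.strong_induction_on generalizing i p with
  | _ k ih =>
    rcases lt_or_ge k 2 with hk | hk
    · exact radialMul_mem_coneSpan (hX him) (mem_harmonicSubmodule.mpr
        ⟨hp, polyLaplacian_eq_zero_of_lt_two hk hp⟩)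
    · obtain ⟨k, rfl⟩ := Nat.exists_eq_add_of_le' hk
      obtain ⟨Y, hY, q, hq, rfl⟩ := exists_harmonic_add_normSqPoly_mul hp
      have hnorm : radialMul d (Polynomial.X ^ i) (normSqPoly (Fin d) ℝ * q)
          = radialMul d (Polynomial.X ^ (i + 2)) q := by
        ext z
        have hz : ∑ j, z.1.1.ofLp j ^ 2 = z.1.2 ^ 2 := by
          rw [← z.2.1, EuclideanSpace.real_norm_sq_eq]
        simp only [radialMul_apply, normSqPoly, map_mul, map_sum, map_pow, eval_X, hz,
          Polynomial.eval_pow, Polynomial.eval_X]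
        ring
      rw [map_add, hnorm]
      exact add_mem (radialMul_mem_coneSpan (hX him) hY) (ih k (by lia) (by lia) hq)

lemma coe_coneSpan_succ (d : ℕ) [NeZero d] (m : ℕ) :
    (coneSpan d (m + 1) : Set (V0 d → ℝ)) = conePoly d m := by
  rw [← coe_conePolySubmodule]
  refine congrArg _ (le_antisymm (coneSpan_succ_le_conePolySubmodule d m)
    (Submodule.map_le_iff_le_comap.mpr fun q hq => ?_))
  rw [Submodule.mem_comap, q.as_sum, map_sum]
  refine Submodule.sum_mem _ fun a ha => ?_
  rw [coneRestrict_monomial]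
  refine radialMul_X_pow_mem_coneSpan (Nat.lt_succ_of_le ?_) (isHomogeneous_monomial _ rfl)
  have hdeg := (le_totalDegree ha).trans ((mem_restrictTotalDegree ..).mp hq)
  rw [Finsupp.sum_fintype _ _ (by simp), Fintype.sum_sum_type] at hdeg
  simpa [Finsupp.degree_eq_sum, add_comm] using hdeg

end ConePolynomials

/-! ### The inner product on the conic surface -/

section ConeInner

open MeasureTheory Set MvPolynomial

/-- The integral of `f` over the sphere `{(tξ, t) : ‖ξ‖ = 1}`, with respect to the surface measure
in `ξ`. -/
def sliceIntegral {d : ℕ} (f : V0 d → ℝ) (t : ℝ) : ℝ :=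
  ∫ ξ : Metric.sphere (0 : E d) 1, polar f ξ t ∂(volume : Measure (E d)).toSphere

/-- The point `(tξ, t)` of the conic surface. -/
def conePoint {d : ℕ} (ξ : Metric.sphere (0 : E d) 1) (t : Icc (0 : ℝ) 1) : V0 d :=
  ⟨((t : ℝ) • (ξ : E d), (t : ℝ)), by
    simp [V0, norm_smul, abs_of_nonneg t.2.1, t.2.1, t.2.2]⟩

variable {d : ℕ}

lemma continuous_conePoint :
    Continuous fun z : Icc (0 : ℝ) 1 × Metric.sphere (0 : E d) 1 => conePoint z.2 z.1 := by
  unfold conePoint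
  fun_prop

lemma polar_eq_conePoint (f : V0 d → ℝ) (ξ : Metric.sphere (0 : E d) 1) (t : Icc (0 : ℝ) 1) :
    polar f ξ t = f (conePoint ξ t) :=
  dif_pos (conePoint ξ t).2

lemma exists_conePoint_eq [NeZero d] (z : V0 d) : ∃ ξ t, conePoint ξ t = z := by
  obtain ⟨⟨x, t⟩, hx, h0, h1⟩ := z
  simp only at hx h0 h1
  obtain ⟨ξ, hξ⟩ : ∃ ξ : Metric.sphere (0 : E d) 1, t • (ξ : E d) = x := by
    rcases h0.eq_or_lt with rfl | ht
    · obtain ⟨ξ, hξ⟩ := NormedSpace.sphere_nonempty (x := (0 : E d)) (r := 1) |>.mpr zero_le_one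
      exact ⟨⟨ξ, hξ⟩, by rw [zero_smul, norm_eq_zero.mp hx]⟩
    · refine ⟨⟨t⁻¹ • x, ?_⟩, smul_inv_smul₀ ht.ne' x⟩
      simp [norm_smul, hx, abs_of_pos ht, ht.ne']
  exact ⟨ξ, ⟨t, h0, h1⟩, Subtype.ext (Prod.ext hξ rfl)⟩

lemma polar_mul (f g : V0 d → ℝ) (ξ : E d) (t : ℝ) :
    polar (f * g) ξ t = polar f ξ t * polar g ξ t := by
  unfold polar
  split_ifs <;> simp

lemma polar_smul (c : ℝ) (f : V0 d → ℝ) (ξ : E d) (t : ℝ) :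
    polar (c • f) ξ t = c * polar f ξ t := by
  unfold polar
  split_ifs <;> simp

lemma sliceIntegral_coe (f : V0 d → ℝ) (t : Icc (0 : ℝ) 1) :
    sliceIntegral f t = ∫ ξ : Metric.sphere (0 : E d) 1, f (conePoint ξ t)
      ∂(volume : Measure (E d)).toSphere := by
  simp only [sliceIntegral, polar_eq_conePoint]

lemma continuousOn_sliceIntegral {f : V0 d → ℝ} (hf : Continuous f) :
    ContinuousOn (sliceIntegral f) (Icc 0 1) := by
  rw [continuousOn_iff_continuous_domRestrict]
  refine (continuous_parametric_integral_of_continuous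
    (μ := (volume : Measure (E d)).toSphere) (f := fun t ξ => f (conePoint ξ t))
    (hf.comp continuous_conePoint) isCompact_univ).congr fun t => ?_
  rw [Measure.restrict_univ, ← sliceIntegral_coe]
  rfl

lemma sliceIntegral_add {f g : V0 d → ℝ} (hf : Continuous f) (hg : Continuous g)
    (t : Icc (0 : ℝ) 1) : sliceIntegral (f + g) t = sliceIntegral f t + sliceIntegral g t := by
  have hint {h : V0 d → ℝ} (hh : Continuous h) :
      Integrable (fun ξ => h (conePoint ξ t)) (volume : Measure (E d)).toSphere :=
    (hh.comp (continuous_conePoint.comp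
      (Continuous.prodMk_right t))).integrable_of_hasCompactSupport
        (HasCompactSupport.of_compactSpace _)
  simp only [sliceIntegral_coe, Pi.add_apply]
  exact integral_add (hint hf) (hint hg)

lemma eq_zero_of_sliceIntegral_eq_zero {f : V0 d → ℝ} (hf : Continuous f) (hf0 : 0 ≤ f)
    {t : Icc (0 : ℝ) 1} (h : sliceIntegral f t = 0) (ξ : Metric.sphere (0 : E d) 1) :
    f (conePoint ξ t) = 0 := by
  by_contra hne
  refine ((hf.comp (continuous_conePoint.comp
    (Continuous.prodMk_right t))).integral_pos_of_hasCompactSupport_nonneg_nonzero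
    (μ := (volume : Measure (E d)).toSphere) (HasCompactSupport.of_compactSpace _)
    (fun η => hf0 _) hne).ne' ?_
  rwa [sliceIntegral_coe] at h

lemma sliceIntegral_radialMul_mul {k l : ℕ} (p q : Polynomial ℝ) {Y Z : MvPolynomial (Fin d) ℝ}
    (hY : Y.IsHomogeneous k) (hZ : Z.IsHomogeneous l) (t : Icc (0 : ℝ) 1) :
    sliceIntegral (radialMul d p Y * radialMul d q Z) t
      = sphereIntegral (Fin d) (Y * Z) * ((p * q).eval (t : ℝ) * (t : ℝ) ^ (k + l)) := by
  rw [sliceIntegral_coe, sphereIntegral_apply, ← integral_mul_const]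
  refine integral_congr_ae (Filter.Eventually.of_forall fun ξ => ?_)
  simp only [Pi.mul_apply, radialMul_apply, conePoint, WithLp.ofLp_smul,
    eval_smul_of_isHomogeneous hY, eval_smul_of_isHomogeneous hZ, map_mul, Polynomial.eval_mul]
  ring

variable {β γ : ℝ}

lemma coneInner_comm (β γ : ℝ) (f g : V0 d → ℝ) : coneInner β γ f g = coneInner β γ g f := by
  simp only [coneInner, mul_comm (polar f _ _)]

lemma coneInner_smul_right (β γ c : ℝ) (f g : V0 d → ℝ) :
    coneInner β γ f (c • g) = c * coneInner β γ f g := by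
  simp only [coneInner, polar_smul, mul_left_comm _ c, mul_assoc, integral_const_mul,
    intervalIntegral.integral_const_mul]

lemma intervalIntegrable_sliceIntegral_mul (hβ : 0 < d + β) (hγ : -1 < γ) {f : V0 d → ℝ}
    (hf : Continuous f) :
    IntervalIntegrable (fun t => sliceIntegral f t * (t ^ ((d : ℝ) - 1 + β) * (1 - t) ^ γ))
      volume 0 1 :=
  (intervalIntegrable_rpow_mul_one_sub_rpow (by linarith) hγ).continuousOn_mul
    (by rw [uIcc_of_le zero_le_one]; exact continuousOn_sliceIntegral hf)

variable [NeZero d]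

lemma coneInner_eq_integral_sliceIntegral (β γ : ℝ) (f g : V0 d → ℝ) :
    coneInner β γ f g
      = ∫ t in (0 : ℝ)..1, sliceIntegral (f * g) t * (t ^ ((d : ℝ) - 1 + β) * (1 - t) ^ γ) := by
  refine intervalIntegral.integral_congr_ae (Filter.Eventually.of_forall fun t ht => ?_)
  rw [uIoc_of_le zero_le_one] at ht
  have hpow : t ^ ((d : ℝ) - 1 + β) = t ^ (d - 1) * t ^ β := by
    rw [Real.rpow_add ht.1, ← Nat.cast_pred (NeZero.pos d), Real.rpow_natCast]
  simp only [sliceIntegral, polar_mul, hpow]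
  ring

lemma coneInner_add_right (hβ : 0 < d + β) (hγ : -1 < γ) {f g h : V0 d → ℝ} (hf : Continuous f)
    (hg : Continuous g) (hh : Continuous h) :
    coneInner β γ f (g + h) = coneInner β γ f g + coneInner β γ f h := by
  simp only [coneInner_eq_integral_sliceIntegral]
  rw [← intervalIntegral.integral_add (intervalIntegrable_sliceIntegral_mul hβ hγ (hf.mul hg))
    (intervalIntegrable_sliceIntegral_mul hβ hγ (hf.mul hh))]
  refine intervalIntegral.integral_congr fun t ht => ?_
  rw [uIcc_of_le zero_le_one] at ht
  rw [← add_mul, mul_add, sliceIntegral_add (hf.mul hg) (hf.mul hh) ⟨t, ht⟩]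

/-- The continuous functions on the conic surface that are orthogonal to a given one. -/
def coneOrthogonal (hβ : 0 < d + β) (hγ : -1 < γ) {f : V0 d → ℝ} (hf : Continuous f) :
    Submodule ℝ (V0 d → ℝ) where
  carrier := {g | Continuous g ∧ coneInner β γ f g = 0}
  zero_mem' := ⟨continuous_zero, by simpa using coneInner_smul_right β γ 0 f 0⟩
  add_mem' {g h} hg hh := ⟨hg.1.add hh.1, by
    rw [coneInner_add_right hβ hγ hf hg.1 hh.1, hg.2, hh.2, add_zero]⟩
  smul_mem' c g hg := ⟨hg.1.const_smul c, by rw [coneInner_smul_right, hg.2, mul_zero]⟩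

lemma eq_zero_of_coneInner_self_eq_zero (hβ : 0 < d + β) (hγ : -1 < γ) {f : V0 d → ℝ}
    (hf : Continuous f) (h : coneInner β γ f f = 0) : f = 0 := by
  have hff0 : 0 ≤ f * f := fun z => mul_self_nonneg (f z)
  have hslice : EqOn (sliceIntegral (f * f)) 0 (Icc 0 1) := by
    refine eqOn_zero_of_integral_mul_rpow_mul_one_sub_rpow_eq_zero (by linarith) hγ
      (continuousOn_sliceIntegral (hf.mul hf)) (fun t ht => ?_)
      ((coneInner_eq_integral_sliceIntegral β γ f f).symm.trans h)
    rw [sliceIntegral_coe _ ⟨t, ht⟩]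
    exact integral_nonneg fun ξ => hff0 _
  funext z
  obtain ⟨ξ, t, rfl⟩ := exists_conePoint_eq z
  exact mul_self_eq_zero.mp
    (eq_zero_of_sliceIntegral_eq_zero (hf.mul hf) hff0 (hslice t.2) ξ)

lemma coneInner_radialMul {k l : ℕ} (p q : Polynomial ℝ) {Y Z : MvPolynomial (Fin d) ℝ}
    (hY : Y.IsHomogeneous k) (hZ : Z.IsHomogeneous l) :
    coneInner β γ (radialMul d p Y) (radialMul d q Z) = sphereIntegral (Fin d) (Y * Z)
      * ∫ t in (0 : ℝ)..1, (p * q).eval t * (t ^ ((k : ℝ) + l + d - 1 + β) * (1 - t) ^ γ) := by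
  rw [coneInner_eq_integral_sliceIntegral, ← intervalIntegral.integral_const_mul]
  refine intervalIntegral.integral_congr_ae (Filter.Eventually.of_forall fun t ht => ?_)
  rw [uIoc_of_le zero_le_one] at ht
  have hpow : t ^ ((k : ℝ) + l + d - 1 + β) = t ^ (k + l) * t ^ ((d : ℝ) - 1 + β) := by
    rw [← Real.rpow_natCast, ← Real.rpow_add ht.1]
    push_cast
    ring_nf
  rw [sliceIntegral_radialMul_mul p q hY hZ ⟨t, ht.1.le, ht.2⟩, hpow]
  ring

end ConeInner

/-! ### Orthogonal polynomials on the conic surface -/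

section OrthogonalPolynomials

open MvPolynomial

open Polynomial (degreeLT)

/-- The span of the products `P_{n-k}^{(2k+a,b)}(1-2t) Y(x)`, where `Y` is a solid harmonic of
degree `k ≤ n`. Both `V_n(w_{β,γ})` and `U_n(w_{-1,-s})` are of this form, with `a = d-1+β`. -/
def jacobiHarmonicSum (d n : ℕ) (a b : ℝ) : Submodule ℝ (V0 d → ℝ) :=
  ⨆ k : Fin (n + 1),
    (harmonicSubmodule (Fin d) ℝ k).map (radialMul d (jacobiPoly (n - k) (2 * k + a) b))

variable {d n : ℕ}

lemma radialMul_mem_jacobiHarmonicSum {k : ℕ} (hk : k ≤ n) (a b : ℝ) {Y : MvPolynomial (Fin d) ℝ}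
    (hY : Y ∈ harmonicSubmodule (Fin d) ℝ k) :
    radialMul d (jacobiPoly (n - k) (2 * k + a) b) Y ∈ jacobiHarmonicSum d n a b :=
  Submodule.mem_iSup_of_mem (⟨k, Nat.lt_succ_of_le hk⟩ : Fin (n + 1))
    (Submodule.mem_map_of_mem hY)

lemma coneSpan_zero (d : ℕ) : coneSpan d 0 = ⊥ := by
  have hbot : degreeLT ℝ 0 = ⊥ := by
    ext p
    simp [Polynomial.mem_degreeLT, Polynomial.ext_iff]
  simp only [coneSpan, Nat.zero_sub, hbot, Submodule.map₂_bot_left, iSup_bot]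

lemma coneSpan_mono {m m' : ℕ} (h : m ≤ m') : coneSpan d m ≤ coneSpan d m' :=
  iSup_mono fun k => Submodule.map₂_le_map₂_left (Polynomial.degreeLT_mono (by lia))

lemma jacobiHarmonicSum_le_coneSpan (a b : ℝ) :
    jacobiHarmonicSum d n a b ≤ coneSpan d (n + 1) := by
  refine iSup_le fun k => Submodule.map_le_iff_le_comap.mpr fun Y hY => ?_
  refine radialMul_mem_coneSpan (Polynomial.mem_degreeLT.mpr ?_) hY
  refine (Polynomial.degree_le_of_natDegree_le (natDegree_jacobiPoly_le _ _ _)).trans_lt ?_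
  exact_mod_cast (by lia : n - (k : ℕ) < n + 1 - k)

lemma exists_sub_C_mul_mem_degreeLT {K : Type*} [Field K] {j : ℕ} {p q : Polynomial K}
    (hp : p ∈ degreeLT K (j + 1)) (hq : q.natDegree ≤ j) (hq0 : q.coeff j ≠ 0) :
    ∃ c, p - Polynomial.C c * q ∈ degreeLT K j := by
  refine ⟨p.coeff j / q.coeff j, Polynomial.mem_degreeLT.mpr
    ((Polynomial.degree_lt_iff_coeff_zero _ _).mpr fun i hi => ?_)⟩
  rcases hi.eq_or_lt with rfl | hi
  · simp [hq0]
  · have hpi := (Polynomial.degree_lt_iff_coeff_zero _ _).mp (Polynomial.mem_degreeLT.mp hp) i hi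
    simp [hpi, Polynomial.coeff_eq_zero_of_natDegree_lt (hq.trans_lt hi)]

lemma coneSpan_succ_le_sup_jacobiHarmonicSum {a b : ℝ} (ha : -1 < a) (hb : -1 < b) :
    coneSpan d (n + 1) ≤ coneSpan d n ⊔ jacobiHarmonicSum d n a b := by
  refine iSup_le fun k => Submodule.map₂_le.mpr fun p hp Y hY => ?_
  rcases le_or_gt k n with hk | hk
  · have hα : -1 < 2 * (k : ℝ) + a := by linarith [Nat.cast_nonneg (α := ℝ) k]
    rw [Nat.succ_sub hk] at hp
    obtain ⟨c, hc⟩ := exists_sub_C_mul_mem_degreeLT hp (natDegree_jacobiPoly_le _ _ _)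
      (coeff_jacobiPoly_self_ne_zero (n - k) hα hb)
    rw [← sub_add_cancel p (Polynomial.C c * jacobiPoly (n - k) (2 * k + a) b), map_add,
      ← Polynomial.smul_eq_C_mul c, map_smul, LinearMap.add_apply, LinearMap.smul_apply]
    rw [← Polynomial.smul_eq_C_mul c] at hc
    exact Submodule.add_mem_sup (radialMul_mem_coneSpan hc hY)
      (Submodule.smul_mem _ c (radialMul_mem_jacobiHarmonicSum hk a b hY))
  · rw [Nat.sub_eq_zero_of_le hk] at hp
    refine Submodule.mem_sup_left (radialMul_mem_coneSpan (Polynomial.degreeLT_mono ?_ hp) hY)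
    exact Nat.zero_le _

variable [NeZero d] {β γ : ℝ}

lemma continuous_of_mem_coneSpan {m : ℕ} {f : V0 d → ℝ} (hf : f ∈ coneSpan d m) :
    Continuous f :=
  continuous_of_mem_conePoly ((coe_coneSpan_succ d m).subset (coneSpan_mono (Nat.le_succ m) hf))

lemma continuous_of_mem_jacobiHarmonicSum {a b : ℝ} {f : V0 d → ℝ}
    (hf : f ∈ jacobiHarmonicSum d n a b) : Continuous f :=
  continuous_of_mem_coneSpan (jacobiHarmonicSum_le_coneSpan a b hf)

lemma coneInner_radialMul_jacobiPoly (hβ : 0 < d + β) (hγ : -1 < γ) {j k l : ℕ}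
    {p : Polynomial ℝ} (hp : k = l → p ∈ degreeLT ℝ j) {Y Z : MvPolynomial (Fin d) ℝ}
    (hY : Y ∈ harmonicSubmodule (Fin d) ℝ k) (hZ : Z ∈ harmonicSubmodule (Fin d) ℝ l) :
    coneInner β γ (radialMul d (jacobiPoly j (2 * k + (d - 1 + β)) γ) Y) (radialMul d p Z)
      = 0 := by
  rw [coneInner_radialMul _ _ hY.1 hZ.1]
  rcases eq_or_ne k l with rfl | hkl
  · have hα : -1 < 2 * (k : ℝ) + (d - 1 + β) := by linarith [Nat.cast_nonneg (α := ℝ) k]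
    have h := jacobiIntegral_jacobiPoly_mul hα hγ (hp rfl)
    rw [jacobiIntegral_apply] at h
    rw [show (k : ℝ) + k + d - 1 + β = 2 * k + (d - 1 + β) by ring, h, mul_zero]
  · rw [sphereIntegral_mul_eq_zero_of_harmonic hkl hY hZ, zero_mul]

lemma coneInner_eq_zero_of_mem_jacobiHarmonicSum (hβ : 0 < d + β) (hγ : -1 < γ) {f g : V0 d → ℝ}
    (hf : f ∈ jacobiHarmonicSum d n (d - 1 + β) γ) (hg : g ∈ coneSpan d n) :
    coneInner β γ f g = 0 := by
  have hgcont := continuous_of_mem_coneSpan hg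
  suffices hle : jacobiHarmonicSum d n (d - 1 + β) γ ≤ coneOrthogonal hβ hγ hgcont by
    rw [coneInner_comm]
    exact (hle hf).2
  refine iSup_le fun k => Submodule.map_le_iff_le_comap.mpr fun Y hY => ?_
  have hPY := radialMul_mem_jacobiHarmonicSum (Nat.le_of_lt_succ k.2) (d - 1 + β) γ hY
  have hPYcont := continuous_of_mem_jacobiHarmonicSum hPY
  suffices hle : coneSpan d n ≤ coneOrthogonal hβ hγ hPYcont from
    ⟨hPYcont, (coneInner_comm β γ _ _).trans (hle hg).2⟩
  refine iSup_le fun l => Submodule.map₂_le.mpr fun p hp Z hZ =>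
    ⟨continuous_of_mem_coneSpan (radialMul_mem_coneSpan hp hZ), ?_⟩
  exact coneInner_radialMul_jacobiPoly hβ hγ (fun hkl => by rwa [hkl]) hY hZ

lemma mem_orthPoly_iff (f : V0 d → ℝ) : f ∈ orthPoly d n β γ ↔
    f ∈ coneSpan d (n + 1) ∧ ∀ g ∈ coneSpan d n, coneInner β γ f g = 0 := by
  simp only [orthPoly, Set.mem_ofPred_eq, ← coe_coneSpan_succ, SetLike.mem_coe]
  refine and_congr_right fun _ => ⟨fun h g hg => ?_, fun h k hk g hg =>
    h g (coneSpan_mono hk hg)⟩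
  rcases n with _ | m
  · rw [coneSpan_zero, Submodule.mem_bot] at hg
    simpa [hg] using coneInner_smul_right β γ 0 f 0
  · exact h m (Nat.lt_succ_self m) g hg

theorem orthPoly_eq_jacobiHarmonicSum (hβ : 0 < d + β) (hγ : -1 < γ) :
    orthPoly d n β γ = jacobiHarmonicSum d n (d - 1 + β) γ := by
  ext f
  rw [mem_orthPoly_iff, SetLike.mem_coe]
  refine ⟨fun ⟨hf, horth⟩ => ?_, fun hf => ⟨jacobiHarmonicSum_le_coneSpan _ _ hf, fun g hg =>
    coneInner_eq_zero_of_mem_jacobiHarmonicSum hβ hγ hf hg⟩⟩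
  obtain ⟨g, hg, h, hh, rfl⟩ := Submodule.mem_sup.mp
    (coneSpan_succ_le_sup_jacobiHarmonicSum (by linarith : -1 < d - 1 + β) hγ hf)
  have hgcont := continuous_of_mem_coneSpan hg
  have hhcont := continuous_of_mem_jacobiHarmonicSum hh
  have hgg : coneInner β γ g g = 0 := by
    have hgh : coneInner β γ g h = 0 :=
      (coneInner_comm β γ g h).trans (coneInner_eq_zero_of_mem_jacobiHarmonicSum hβ hγ hh hg)
    rw [← horth g hg, coneInner_comm _ _ (g + h), coneInner_add_right hβ hγ hgcont hgcont hhcont,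
      hgh, add_zero]
  rwa [eq_zero_of_coneInner_self_eq_zero hβ hγ hgcont hgg, zero_add]

end OrthogonalPolynomials

/-! ### The differential operator on the conic surface -/

section DifferentialOperator

open MvPolynomial

open Set (Icc Ioc EqOn Ioc_subset_Icc_self)

section NormPow

variable {ι : Type*} [Fintype ι]

/-- The function `x ↦ ‖x‖^{2a} p(x)`; for `2a = -deg p` it is the extension of `p` from the sphere
that is homogeneous of degree zero. -/
def normPowMul (a : ℝ) (p : MvPolynomial ι ℝ) (x : EuclideanSpace ℝ ι) : ℝ :=
  (‖x‖ ^ 2) ^ a * eval x.ofLp p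

lemma contDiffAt_normPowMul (a : ℝ) (p : MvPolynomial ι ℝ) {x : EuclideanSpace ℝ ι} (hx : x ≠ 0) :
    ContDiffAt ℝ 2 (normPowMul a p) x := by
  have hp : ContDiff ℝ 2 fun y : EuclideanSpace ℝ ι => eval y.ofLp p := by
    simp only [eval_eq]
    fun_prop
  exact ((contDiff_norm_sq ℝ).contDiffAt.rpow_const_of_ne (by positivity)).mul hp.contDiffAt

lemma fderiv_normPowMul_single [DecidableEq ι] (a : ℝ) (p : MvPolynomial ι ℝ)
    {x : EuclideanSpace ℝ ι} (hx : x ≠ 0) (i : ι) :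
    fderiv ℝ (normPowMul a p) x (EuclideanSpace.single i 1)
      = normPowMul (a - 1) (C (2 * a) * (X i * p)) x + normPowMul a (pderiv i p) x := by
  have hpow := (hasStrictFDerivAt_norm_sq x).hasFDerivAt.rpow_const (p := a)
    (Or.inl (by positivity))
  have hmul : HasFDerivAt (normPowMul a p) _ x := hpow.mul (hasFDerivAt_eval p x)
  rw [hmul.fderiv, _root_.add_apply, _root_.smul_apply, ← (hasFDerivAt_eval p x).fderiv,
    fderiv_eval_single]
  simp only [_root_.smul_apply, normPowMul, smul_eq_mul, map_mul, eval_C, eval_X,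
    coe_innerSL_apply, EuclideanSpace.inner_single_right, conj_trivial, one_mul, nsmul_eq_mul,
    Nat.cast_ofNat]
  ring

lemma laplacian_eq_sum_fderiv_fderiv_single [DecidableEq ι] {f : EuclideanSpace ℝ ι → ℝ}
    {x : EuclideanSpace ℝ ι} (hf : ContDiffAt ℝ 2 f x) :
    (Laplacian.laplacian f : EuclideanSpace ℝ ι → ℝ) x
      = ∑ i, fderiv ℝ (fun y => fderiv ℝ f y (EuclideanSpace.single i 1)) x
          (EuclideanSpace.single i 1) := by
  have hdiff : DifferentiableAt ℝ (fderiv ℝ f) x :=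
    (hf.fderiv_right (m := 1) (by norm_num)).differentiableAt (by norm_num)
  rw [InnerProductSpace.laplacian_eq_iteratedFDeriv_orthonormalBasis _
    (EuclideanSpace.basisFun ι ℝ)]
  refine Finset.sum_congr rfl fun i _ => ?_
  rw [iteratedFDeriv_two_apply, fderiv_clm_apply hdiff (differentiableAt_const _)]
  simp

lemma fderiv_fderiv_normPowMul_single [DecidableEq ι] (a : ℝ) (p : MvPolynomial ι ℝ)
    {x : EuclideanSpace ℝ ι} (hx : x ≠ 0) (i : ι) :
    fderiv ℝ (fun y => fderiv ℝ (normPowMul a p) y (EuclideanSpace.single i 1)) x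
        (EuclideanSpace.single i 1)
      = (‖x‖ ^ 2) ^ (a - 1 - 1) * (4 * a * (a - 1) * eval x.ofLp p) * x i ^ 2
        + (‖x‖ ^ 2) ^ (a - 1)
          * (2 * a * eval x.ofLp p + 4 * a * eval x.ofLp (X i * pderiv i p))
        + (‖x‖ ^ 2) ^ a * eval x.ofLp (pderiv i (pderiv i p)) := by
  have hfirst : (fun y => fderiv ℝ (normPowMul a p) y (EuclideanSpace.single i 1)) =ᶠ[nhds x]
      normPowMul (a - 1) (C (2 * a) * (X i * p)) + normPowMul a (pderiv i p) := by
    filter_upwards [isOpen_ne.mem_nhds hx] with y hy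
    exact fderiv_normPowMul_single a p hy i
  rw [hfirst.fderiv_eq, fderiv_add
      ((contDiffAt_normPowMul _ _ hx).differentiableAt (by norm_num))
      ((contDiffAt_normPowMul _ _ hx).differentiableAt (by norm_num)),
    _root_.add_apply, fderiv_normPowMul_single _ _ hx, fderiv_normPowMul_single _ _ hx]
  simp only [normPowMul, Derivation.leibniz, smul_eq_mul, map_mul, map_add, eval_C, eval_X,
    pderiv_C, pderiv_X_self, mul_zero, add_zero, map_one]
  ring

lemma laplacian_normPowMul_of_mem_harmonicSubmodule {m : ℕ} {Y : MvPolynomial ι ℝ}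
    (hY : Y ∈ harmonicSubmodule ι ℝ m) (a : ℝ) {x : EuclideanSpace ℝ ι} (hx : x ≠ 0) :
    (Laplacian.laplacian (normPowMul a Y) : EuclideanSpace ℝ ι → ℝ) x
      = 2 * a * (2 * (a - 1) + Fintype.card ι + 2 * m) * normPowMul (a - 1) Y x := by
  classical
  obtain ⟨hom, hharm⟩ := mem_harmonicSubmodule.mp hY
  have heuler : ∑ i, eval x.ofLp (X i * pderiv i Y) = m * eval x.ofLp Y := by
    simpa using congrArg (eval x.ofLp) hom.sum_X_mul_pderiv
  have hlap : ∑ i, eval x.ofLp (pderiv i (pderiv i Y)) = 0 := by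
    simpa [polyLaplacian_apply] using congrArg (eval x.ofLp) hharm
  have hpow : (‖x‖ ^ 2) ^ (a - 1 - 1) * ‖x‖ ^ 2 = (‖x‖ ^ 2) ^ (a - 1) := by
    rw [Real.rpow_sub_one (by positivity) (a - 1), div_mul_cancel₀ _ (by positivity)]
  simp only [laplacian_eq_sum_fderiv_fderiv_single (contDiffAt_normPowMul a Y hx),
    fderiv_fderiv_normPowMul_single a Y hx, Finset.sum_add_distrib, ← Finset.mul_sum,
    ← EuclideanSpace.real_norm_sq_eq, heuler, hlap, Finset.sum_const, Finset.card_univ,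
    nsmul_eq_mul, normPowMul]
  linear_combination (4 * a * (a - 1) * eval x.ofLp Y) * hpow

end NormPow

variable {d m : ℕ}

lemma eqOn_normPowMul_of_eqOn_sphere {Y : MvPolynomial (Fin d) ℝ} (hY : Y.IsHomogeneous m)
    {g : E d → ℝ} (hg : EqOn g (fun η => eval η.ofLp Y) (Metric.sphere 0 1)) :
    EqOn (fun x => g (‖x‖⁻¹ • x)) (normPowMul (-(m : ℝ) / 2) Y) {0}ᶜ := by
  intro x hx
  have hx0 : 0 < ‖x‖ := norm_pos_iff.mpr hx
  have hmem : ‖x‖⁻¹ • x ∈ Metric.sphere (0 : E d) 1 := by simp [norm_smul, hx0.ne']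
  have hpow : ‖x‖⁻¹ ^ m = (‖x‖ ^ 2) ^ (-(m : ℝ) / 2) := by
    rw [← Real.rpow_natCast ‖x‖ 2, ← Real.rpow_mul hx0.le, inv_pow, ← Real.rpow_natCast,
      ← Real.rpow_neg hx0.le]
    congr 1
    push_cast
    ring
  simp only [hg hmem, normPowMul, WithLp.ofLp_smul, eval_smul_of_isHomogeneous hY, hpow]

theorem laplaceBeltrami_of_mem_harmonicSubmodule {Y : MvPolynomial (Fin d) ℝ}
    (hY : Y ∈ harmonicSubmodule (Fin d) ℝ m) {g : E d → ℝ}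
    (hg : EqOn g (fun η => eval η.ofLp Y) (Metric.sphere 0 1)) {ξ : E d}
    (hξ : ξ ∈ Metric.sphere (0 : E d) 1) :
    laplaceBeltrami g ξ = -(m * (m + d - 2)) * g ξ := by
  have hξ0 : ξ ≠ 0 := ne_zero_of_mem_unit_sphere ⟨ξ, hξ⟩
  rw [laplaceBeltrami, (InnerProductSpace.laplacian_congr_nhds
      ((eqOn_normPowMul_of_eqOn_sphere hY.1 hg).eventuallyEq_of_mem
        (isOpen_compl_singleton.mem_nhds hξ0))).eq_of_nhds,
    laplacian_normPowMul_of_mem_harmonicSubmodule hY _ hξ0, hg hξ, normPowMul,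
    mem_sphere_zero_iff_norm.mp hξ, Fintype.card_fin, one_pow, Real.one_rpow]
  ring

lemma polar_radialMul (p : Polynomial ℝ) {Y : MvPolynomial (Fin d) ℝ} (hY : Y.IsHomogeneous m)
    {ξ : E d} (hξ : ξ ∈ Metric.sphere (0 : E d) 1) {t : ℝ} (ht : t ∈ Icc (0 : ℝ) 1) :
    polar (radialMul d p Y) ξ t = (p * Polynomial.X ^ m).eval t * eval ξ.ofLp Y := by
  refine (polar_eq_conePoint _ ⟨ξ, hξ⟩ ⟨t, ht⟩).trans ?_
  simp only [radialMul_apply, conePoint, WithLp.ofLp_smul, eval_smul_of_isHomogeneous hY,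
    Polynomial.eval_mul, Polynomial.eval_pow, Polynomial.eval_X, mul_assoc]

lemma polar_add (f g : V0 d → ℝ) (ξ : E d) (t : ℝ) :
    polar (f + g) ξ t = polar f ξ t + polar g ξ t := by
  unfold polar
  split_ifs <;> simp

lemma polar_zero (ξ : E d) (t : ℝ) : polar (0 : V0 d → ℝ) ξ t = 0 := by
  simp [polar]

/-- The functions on the conic surface that are twice continuously differentiable in `t ∈ [0,1]`
and in `ξ`, so that `diffOp` consists of genuine derivatives. -/
def coneSmooth (d : ℕ) : Submodule ℝ (V0 d → ℝ) where
  carrier := {f | ∀ ξ ∈ Metric.sphere (0 : E d) 1,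
    ContDiffOn ℝ 2 (fun τ => polar f ξ τ) (Icc 0 1) ∧
    ∀ t ∈ Icc (0 : ℝ) 1, ContDiffAt ℝ 2 (fun x : E d => polar f (‖x‖⁻¹ • x) t) ξ}
  add_mem' hf hg ξ hξ := by
    simp only [polar_add]
    exact ⟨(hf ξ hξ).1.add (hg ξ hξ).1, fun t ht => ((hf ξ hξ).2 t ht).add ((hg ξ hξ).2 t ht)⟩
  zero_mem' ξ _ := by
    simp only [polar_zero]
    exact ⟨contDiffOn_const, fun _ _ => contDiffAt_const⟩
  smul_mem' c f hf ξ hξ := by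
    simp only [polar_smul]
    exact ⟨contDiffOn_const.mul (hf ξ hξ).1, fun t ht => contDiffAt_const.mul ((hf ξ hξ).2 t ht)⟩

lemma diffOp_add (γ : ℝ) {f g : V0 d → ℝ} (hf : f ∈ coneSmooth d) (hg : g ∈ coneSmooth d)
    {ξ : E d} (hξ : ξ ∈ Metric.sphere (0 : E d) 1) {t : ℝ} (ht : t ∈ Icc (0 : ℝ) 1) :
    diffOp γ (f + g) ξ t = diffOp γ f ξ t + diffOp γ g ξ t := by
  have hu : UniqueDiffOn ℝ (Icc (0 : ℝ) 1) := uniqueDiffOn_Icc one_pos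
  have hft := (hf ξ hξ).1 t ht
  have hgt := (hg ξ hξ).1 t ht
  have hξlap := ((hf ξ hξ).2 t ht).laplacian_add ((hg ξ hξ).2 t ht)
  simp only [diffOp, laplaceBeltrami, polar_add]
  rw [iteratedDerivWithin_fun_add ht hu hft hgt, derivWithin_fun_add
    (hft.differentiableWithinAt (by norm_num)) (hgt.differentiableWithinAt (by norm_num))]
  linear_combination t⁻¹ * hξlap

lemma diffOp_smul (γ : ℝ) {f : V0 d → ℝ} (hf : f ∈ coneSmooth d) (c : ℝ)
    {ξ : E d} (hξ : ξ ∈ Metric.sphere (0 : E d) 1) {t : ℝ} (ht : t ∈ Icc (0 : ℝ) 1) :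
    diffOp γ (c • f) ξ t = c * diffOp γ f ξ t := by
  have hu : UniqueDiffOn ℝ (Icc (0 : ℝ) 1) := uniqueDiffOn_Icc one_pos
  have hft := (hf ξ hξ).1 t ht
  have hξlap := InnerProductSpace.laplacian_smul c ((hf ξ hξ).2 t ht)
  simp only [diffOp, laplaceBeltrami, polar_smul]
  rw [iteratedDerivWithin_const_mul ht hu c hft, derivWithin_const_mul c
    (hft.differentiableWithinAt (by norm_num))]
  linear_combination t⁻¹ * hξlap

/-- The smooth functions `f` on the conic surface with `D_γ f = μ f` for `0 < t ≤ 1`. -/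
def diffOpEigenspace (d : ℕ) (γ μ : ℝ) : Submodule ℝ (V0 d → ℝ) where
  carrier := {f | f ∈ coneSmooth d ∧ ∀ ξ ∈ Metric.sphere (0 : E d) 1, ∀ t ∈ Ioc (0 : ℝ) 1,
    diffOp γ f ξ t = μ * polar f ξ t}
  add_mem' hf hg := ⟨add_mem hf.1 hg.1, fun ξ hξ t ht => by
    rw [diffOp_add γ hf.1 hg.1 hξ (Ioc_subset_Icc_self ht), hf.2 ξ hξ t ht, hg.2 ξ hξ t ht,
      polar_add, mul_add]⟩
  zero_mem' := ⟨zero_mem _, fun ξ hξ t ht => by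
    rw [polar_zero, mul_zero, ← zero_smul ℝ (0 : V0 d → ℝ),
      diffOp_smul γ (zero_mem _) 0 hξ (Ioc_subset_Icc_self ht), zero_mul]⟩
  smul_mem' c f hf := ⟨Submodule.smul_mem _ c hf.1, fun ξ hξ t ht => by
    rw [diffOp_smul γ hf.1 c hξ (Ioc_subset_Icc_self ht), hf.2 ξ hξ t ht, polar_smul,
      mul_left_comm]⟩

lemma contDiff_polynomial_eval (p : Polynomial ℝ) : ContDiff ℝ 2 fun t => p.eval t := by
  simpa using p.contDiff_aeval (𝕜 := ℝ) 2

lemma radialMul_mem_coneSmooth (p : Polynomial ℝ) {Y : MvPolynomial (Fin d) ℝ}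
    (hY : Y.IsHomogeneous m) : radialMul d p Y ∈ coneSmooth d := by
  refine fun ξ hξ => ⟨?_, fun t ht => ?_⟩
  · exact ((contDiff_polynomial_eval (p * Polynomial.X ^ m)).mul contDiff_const).contDiffOn.congr
      fun t ht => polar_radialMul p hY hξ ht
  · have hξ0 : ξ ≠ 0 := ne_zero_of_mem_unit_sphere ⟨ξ, hξ⟩
    have hsphere : EqOn (fun η => polar (radialMul d p Y) η t)
        (fun η => eval η.ofLp (C ((p * Polynomial.X ^ m).eval t) * Y)) (Metric.sphere 0 1) :=
      fun η hη => by simp only [polar_radialMul p hY hη ht, map_mul, eval_C]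
    exact (contDiffAt_normPowMul _ _ hξ0).congr_of_eventuallyEq
      ((eqOn_normPowMul_of_eqOn_sphere (hY.C_mul _) hsphere).eventuallyEq_of_mem
        (isOpen_compl_singleton.mem_nhds hξ0))

lemma derivWithin_polynomial_eval (p : Polynomial ℝ) {t : ℝ} (ht : t ∈ Icc (0 : ℝ) 1) :
    derivWithin (fun τ => p.eval τ) (Icc 0 1) t = (Polynomial.derivative p).eval t :=
  (p.hasDerivAt t).hasDerivWithinAt.derivWithin (uniqueDiffOn_Icc one_pos t ht)

lemma iteratedDerivWithin_two_polynomial_eval (p : Polynomial ℝ) {t : ℝ}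
    (ht : t ∈ Icc (0 : ℝ) 1) :
    iteratedDerivWithin 2 (fun τ => p.eval τ) (Icc 0 1) t
      = (Polynomial.derivative (Polynomial.derivative p)).eval t := by
  rw [iteratedDerivWithin_succ, ← derivWithin_polynomial_eval _ ht]
  refine derivWithin_congr (fun τ hτ => ?_) ?_ <;>
  rw [iteratedDerivWithin_one, derivWithin_polynomial_eval _ ‹_›]

lemma diffOp_radialMul (γ : ℝ) (p : Polynomial ℝ) {Y : MvPolynomial (Fin d) ℝ}
    (hY : Y ∈ harmonicSubmodule (Fin d) ℝ m) {ξ : E d} (hξ : ξ ∈ Metric.sphere (0 : E d) 1)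
    {t : ℝ} (ht : t ∈ Icc (0 : ℝ) 1) :
    diffOp γ (radialMul d p Y) ξ t
      = ((jacobiOp (d - 2) γ (p * Polynomial.X ^ m)).eval t
        - m * (m + d - 2) * (t⁻¹ * (p * Polynomial.X ^ m).eval t)) * eval ξ.ofLp Y := by
  have hpolar : ∀ η ∈ Metric.sphere (0 : E d) 1, ∀ τ ∈ Icc (0 : ℝ) 1,
      polar (radialMul d p Y) η τ = (p * Polynomial.X ^ m).eval τ * eval η.ofLp Y :=
    fun η hη τ hτ => polar_radialMul p hY.1 hη hτ
  generalize p * Polynomial.X ^ m = P at hpolar ⊢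
  have hradial : EqOn (fun τ => polar (radialMul d p Y) ξ τ)
      (fun τ => (P * Polynomial.C (eval ξ.ofLp Y)).eval τ) (Icc 0 1) := fun τ hτ => by
    simp only [hpolar ξ hξ τ hτ, Polynomial.eval_mul, Polynomial.eval_C]
  have hLB : laplaceBeltrami (fun η => polar (radialMul d p Y) η t) ξ
      = -(m * (m + d - 2)) * polar (radialMul d p Y) ξ t :=
    laplaceBeltrami_of_mem_harmonicSubmodule (Submodule.smul_mem _ (P.eval t) hY)
      (fun η hη => by simp only [hpolar η hη t ht, smul_eval]) hξ
  rw [diffOp, iteratedDerivWithin_congr hradial ht, derivWithin_congr hradial (hradial ht),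
    iteratedDerivWithin_two_polynomial_eval _ ht, derivWithin_polynomial_eval _ ht, hLB,
    hpolar ξ hξ t ht]
  simp only [jacobiOp, Polynomial.derivative_mul, Polynomial.derivative_C, mul_zero, add_zero,
    Polynomial.eval_add, Polynomial.eval_sub, Polynomial.eval_mul, Polynomial.eval_C,
    Polynomial.eval_X, Polynomial.eval_one]
  ring

theorem jacobiHarmonicSum_le_diffOpEigenspace (d n : ℕ) (γ : ℝ) :
    jacobiHarmonicSum d n (d - 2) γ ≤ diffOpEigenspace d γ (-n * (n + γ + d - 1)) := by
  refine iSup_le fun k => Submodule.map_le_iff_le_comap.mpr fun Y hY =>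
    ⟨radialMul_mem_coneSmooth _ hY.1, fun ξ hξ t ht => ?_⟩
  set p := jacobiPoly (n - k) (2 * (k : ℕ) + (d - 2)) γ
  have hjac := congrArg (Polynomial.eval t) (X_mul_jacobiOp_mul_X_pow (d - 2) γ p k)
  rw [add_comm ((d : ℝ) - 2), jacobiOp_jacobiPoly, Nat.cast_sub (Nat.le_of_lt_succ k.2)] at hjac
  simp only [Polynomial.eval_mul, Polynomial.eval_add, Polynomial.eval_sub, Polynomial.eval_neg,
    Polynomial.eval_pow, Polynomial.eval_X, Polynomial.eval_C] at hjac
  rw [diffOp_radialMul γ p hY hξ (Ioc_subset_Icc_self ht),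
    polar_radialMul p hY.1 hξ (Ioc_subset_Icc_self ht)]
  simp only [Polynomial.eval_mul, Polynomial.eval_pow, Polynomial.eval_X]
  refine mul_left_cancel₀ ht.1.ne' ?_
  linear_combination eval ξ.ofLp Y * hjac
    - k * (k + d - 2) * (p.eval t * t ^ (k : ℕ)) * eval ξ.ofLp Y * mul_inv_cancel₀ ht.1.ne'

end DifferentialOperator

/-! ### The space `U_n` as a direct sum over the harmonic degree -/

section SpaceU

open MvPolynomial

lemma range_lsum {R ι N : Type*} [CommSemiring R] [Fintype ι] [DecidableEq ι] {M : ι → Type*}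
    [∀ i, AddCommMonoid (M i)] [∀ i, Module R (M i)] [AddCommMonoid N] [Module R N]
    (φ : ∀ i, M i →ₗ[R] N) : LinearMap.range (LinearMap.lsum R M R φ) = ⨆ i, (φ i).range := by
  refine le_antisymm ?_ (iSup_le fun i => ?_)
  · rintro _ ⟨x, rfl⟩
    rw [LinearMap.lsum_apply, LinearMap.sum_apply]
    exact Submodule.sum_mem _ fun i _ => Submodule.mem_iSup_of_mem i ⟨x i, rfl⟩
  · rintro _ ⟨x, rfl⟩
    exact ⟨Pi.single i x, LinearMap.lsum_piSingle ..⟩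

variable {d : ℕ}

/- At a radius `t` where `q_l(t) t^l ≠ 0`, the `l`-th summand is recovered from the restriction
to a sphere. -/
lemma injective_lsum_radialMul [NeZero d] {κ : Type*} [Fintype κ] [DecidableEq κ] {deg : κ → ℕ}
    (hdeg : Function.Injective deg) {q : κ → Polynomial ℝ} (hq : ∀ k, q k ≠ 0) :
    Function.Injective (LinearMap.lsum ℝ (fun k => harmonicSubmodule (Fin d) ℝ (deg k)) ℝ
      fun k => radialMul d (q k) ∘ₗ Submodule.subtype _) := by
  refine (injective_iff_map_eq_zero _).mpr fun Y hY => funext fun l => Subtype.ext ?_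
  obtain ⟨t, ht, hqt⟩ : ∃ t ∈ Set.Icc (0 : ℝ) 1, (q l * Polynomial.X ^ deg l).eval t ≠ 0 := by
    by_contra! h
    exact mul_ne_zero (hq l) (pow_ne_zero _ Polynomial.X_ne_zero)
      (Polynomial.eq_zero_of_infinite_isRoot _ ((Set.Icc_infinite zero_lt_one).mono h))
  have hsum : ∀ ξ ∈ Metric.sphere (0 : EuclideanSpace ℝ (Fin d)) 1, eval ξ.ofLp
      (∑ k, (q k * Polynomial.X ^ deg k).eval t • (Y k : MvPolynomial (Fin d) ℝ)) = 0 := by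
    intro ξ hξ
    have hpt := congrFun hY (conePoint ⟨ξ, hξ⟩ ⟨t, ht⟩)
    rw [LinearMap.lsum_apply, LinearMap.sum_apply, Finset.sum_apply] at hpt
    simp only [map_sum, smul_eval, ← polar_radialMul _ (Y _).2.1 hξ ht]
    exact (Finset.sum_congr rfl fun k _ => polar_eq_conePoint _ ⟨ξ, hξ⟩ ⟨t, ht⟩).trans hpt
  exact (smul_eq_zero.mp (eq_zero_of_sum_harmonic_eval_sphere_eq_zero hdeg
    (fun k => Submodule.smul_mem _ _ (Y k).2) hsum l)).resolve_left hqt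

theorem finrank_jacobiHarmonicSum (hd : 2 ≤ d) (n : ℕ) {a : ℝ} (ha : -1 < a) (b : ℝ) :
    Module.finrank ℝ (jacobiHarmonicSum d n a b)
      = (n + d - 1).choose (d - 1) + (n + d - 2).choose (d - 1) := by
  have : NeZero d := ⟨by lia⟩
  have : Nontrivial (Fin d) := Fin.nontrivial_iff_two_le.mpr hd
  have hne (k : Fin (n + 1)) : jacobiPoly (n - k) (2 * (k : ℕ) + a) b ≠ 0 := fun h =>
    coeff_jacobiPoly_zero_ne_zero (n - k)
      (by linarith [Nat.cast_nonneg (α := ℝ) (k : ℕ)] : -1 < 2 * ((k : ℕ) : ℝ) + a) b (by simp [h])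
  have hrange : jacobiHarmonicSum d n a b = LinearMap.range (LinearMap.lsum ℝ _ ℝ
      fun k : Fin (n + 1) => radialMul d (jacobiPoly (n - k) (2 * (k : ℕ) + a) b)
        ∘ₗ (harmonicSubmodule (Fin d) ℝ k).subtype) := by
    simp only [range_lsum, jacobiHarmonicSum, LinearMap.range_comp, Submodule.range_subtype]
  rw [hrange, LinearMap.finrank_range_of_inj (injective_lsum_radialMul Fin.val_injective hne),
    Module.finrank_pi_fintype,
    Fin.sum_univ_eq_sum_range (fun k => Module.finrank ℝ (harmonicSubmodule (Fin d) ℝ k)),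
    sum_finrank_harmonicSubmodule_eq_choose, Fintype.card_fin]

lemma mulHarmonic_jacobiP (j : ℕ) (α β : ℝ) (Y : MvPolynomial (Fin d) ℝ) :
    mulHarmonic (fun t => jacobiP j α β (1 - 2 * t)) Y = radialMul d (jacobiPoly j α β) Y := by
  simp only [← eval_jacobiPoly]
  rfl

lemma mulHarmonic_one (Y : MvPolynomial (Fin d) ℝ) :
    mulHarmonic (fun _ => 1) Y = radialMul d 1 Y := by
  ext z
  simp [mulHarmonic, radialMul_apply]

lemma radialMul_one_sub_X_pow_mul (s : ℕ) (p : Polynomial ℝ) :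
    radialMul d ((1 - Polynomial.X) ^ s * p)
      = LinearMap.mulLeft ℝ (fun z : V0 d => (1 - z.1.2) ^ s) ∘ₗ radialMul d p := by
  ext Y z
  simp [radialMul_apply, mul_assoc]

lemma map_mulLeft_jacobiHarmonicSum {a : ℝ} (ha : -1 < a) (m s : ℕ) :
    (jacobiHarmonicSum d m a s).map (LinearMap.mulLeft ℝ fun z : V0 d => (1 - z.1.2) ^ s)
      = ⨆ k : Fin (m + 1), (harmonicSubmodule (Fin d) ℝ k).map
          (radialMul d (jacobiPoly (m + s - k) (2 * k + a) (-s))) := by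
  rw [jacobiHarmonicSum, Submodule.map_iSup]
  refine iSup_congr fun k => ?_
  obtain ⟨c, hc, h⟩ := exists_jacobiPoly_neg_eq
    (by linarith [Nat.cast_nonneg (α := ℝ) (k : ℕ)] : -1 < 2 * ((k : ℕ) : ℝ) + a) (m - k) s
  rw [← Nat.sub_add_comm (Nat.le_of_lt_succ k.2)] at h
  rw [h, ← Polynomial.smul_eq_C_mul, map_smul, Submodule.map_smul _ _ c hc,
    radialMul_one_sub_X_pow_mul, Submodule.map_comp]

lemma orthPoly_neg_one_eq_jacobiHarmonicSum (hd : 2 ≤ d) (m s : ℕ) :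
    orthPoly d m (-1) s = jacobiHarmonicSum d m (d - 2) s := by
  have : NeZero d := ⟨by lia⟩
  have hd' : (2 : ℝ) ≤ d := by exact_mod_cast hd
  rw [orthPoly_eq_jacobiHarmonicSum (by linarith)
    (by linarith [Nat.cast_nonneg (α := ℝ) s]), show (d : ℝ) - 1 + -1 = d - 2 by ring]

lemma one_sub_pow_mul_orthPoly_eq (hd : 2 ≤ d) (m s : ℕ) :
    {f | ∃ g ∈ orthPoly d m (-1) s, f = fun z : V0 d => (1 - z.1.2) ^ s * g z}
      = (⨆ k : Fin (m + 1), (harmonicSubmodule (Fin d) ℝ k).map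
          (radialMul d (jacobiPoly (m + s - k) (2 * k + (d - 2)) (-s))) :
            Submodule ℝ (V0 d → ℝ)) := by
  have hd' : (2 : ℝ) ≤ d := by exact_mod_cast hd
  rw [← map_mulLeft_jacobiHarmonicSum (by linarith), orthPoly_neg_one_eq_jacobiHarmonicSum hd,
    Submodule.map_coe]
  ext f
  simp only [Set.mem_ofPred_eq, Set.mem_image, eq_comm (a := f)]
  rfl

lemma spaceU_le_jacobiHarmonicSum (hd : 2 ≤ d) (n s : ℕ) :
    spaceU d n s ≤ jacobiHarmonicSum d n (d - 2) (-s) := by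
  simp only [spaceU, ← coe_harmonicSubmodule, SetLike.mem_coe]
  refine Submodule.span_le.mpr (Set.union_subset (Set.union_subset ?_ ?_) ?_)
  · rintro _ ⟨Y, hY, rfl⟩
    have hmem := radialMul_mem_jacobiHarmonicSum le_rfl (d - 2) (-s) hY
    rwa [Nat.sub_self, jacobiPoly_zero, ← mulHarmonic_one] at hmem
  · rintro _ ⟨j, -, -, hjn, Y, hY, rfl⟩
    have hα : 2 * (n : ℝ) - 2 * j + d - 2 = 2 * ((n - j : ℕ) : ℝ) + (d - 2) := by
      push_cast [hjn]
      ring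
    rw [mulHarmonic_jacobiP, hα]
    have hmem := radialMul_mem_jacobiHarmonicSum (Nat.sub_le n j) (d - 2) (-s) hY
    rwa [Nat.sub_sub_self hjn] at hmem
  · rintro f ⟨hsn, hf⟩
    have hmem := (one_sub_pow_mul_orthPoly_eq hd (n - s) s).subset hf
    rw [Nat.sub_add_cancel hsn] at hmem
    refine (iSup_le fun k => ?_ : _ ≤ jacobiHarmonicSum d n (d - 2) (-s)) hmem
    exact Submodule.map_le_iff_le_comap.mpr fun Y =>
      radialMul_mem_jacobiHarmonicSum (by lia : (k : ℕ) ≤ n) _ _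

lemma jacobiHarmonicSum_le_spaceU (hd : 2 ≤ d) (n s : ℕ) :
    jacobiHarmonicSum d n (d - 2) (-s) ≤ spaceU d n s := by
  refine iSup_le fun ⟨k, hk⟩ => Submodule.map_le_iff_le_comap.mpr fun Y hY =>
    Submodule.subset_span ?_
  have hY' := (coe_harmonicSubmodule d k).subset hY
  obtain ⟨j, rfl⟩ := Nat.exists_eq_add_of_le (Nat.le_of_lt_succ hk)
  rcases le_or_gt s j with hsj | hsj
  · refine Or.inr ⟨by lia, (one_sub_pow_mul_orthPoly_eq hd (k + j - s) s).superset ?_⟩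
    rw [Nat.sub_add_cancel (by lia)]
    exact Submodule.mem_iSup_of_mem (⟨k, by lia⟩ : Fin (k + j - s + 1))
      (Submodule.mem_map_of_mem hY)
  rcases j.eq_zero_or_pos with rfl | hj
  · refine Or.inl (Or.inl ⟨Y, hY', ?_⟩)
    rw [mulHarmonic_one, Nat.add_sub_cancel_left, jacobiPoly_zero]
  · refine Or.inl (Or.inr ⟨j, hj, by lia, by lia, Y, by rwa [Nat.add_sub_cancel], ?_⟩)
    have hα : 2 * ((k + j : ℕ) : ℝ) - 2 * j + d - 2 = 2 * k + (d - 2) := by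
      push_cast
      ring
    rw [mulHarmonic_jacobiP, hα, Nat.add_sub_cancel_left]

theorem spaceU_eq_jacobiHarmonicSum (hd : 2 ≤ d) (n s : ℕ) :
    spaceU d n s = jacobiHarmonicSum d n (d - 2) (-s) :=
  le_antisymm (spaceU_le_jacobiHarmonicSum hd n s) (jacobiHarmonicSum_le_spaceU hd n s)

end SpaceU

end ConicSurface

end

theorem mainTheorem9_general (d n s : ℕ) (hd : 2 ≤ d) :
    (∀ Z ∈ ConicSurface.spaceU d n s,
      ∀ ξ ∈ Metric.sphere (0 : EuclideanSpace ℝ (Fin d)) 1, ∀ t ∈ Set.Ioc (0 : ℝ) 1,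
        ConicSurface.diffOp (-(s : ℝ)) Z ξ t
          = -(n : ℝ) * ((n : ℝ) - (s : ℝ) + (d : ℝ) - 1) * ConicSurface.polar Z ξ t) ∧
    Module.finrank ℝ (ConicSurface.spaceU d n s)
      = (n + d - 1).choose (d - 1) + (n + d - 2).choose (d - 1) := by
  have hd' : (2 : ℝ) ≤ d := by exact_mod_cast hd
  rw [ConicSurface.spaceU_eq_jacobiHarmonicSum hd]
  refine ⟨fun Z hZ => ?_, ConicSurface.finrank_jacobiHarmonicSum hd n (by linarith) _⟩
  have heigen := (ConicSurface.jacobiHarmonicSum_le_diffOpEigenspace d n (-s) hZ).2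
  rwa [← sub_eq_add_neg] at heigen

theorem mainTheorem9 (d n s : ℕ) (hd : 2 ≤ d) (hs : 2 ≤ s) :
    (∀ Z ∈ ConicSurface.spaceU d n s,
      ∀ ξ ∈ Metric.sphere (0 : EuclideanSpace ℝ (Fin d)) 1, ∀ t ∈ Set.Ioc (0 : ℝ) 1,
        ConicSurface.diffOp (-(s : ℝ)) Z ξ t
          = -(n : ℝ) * ((n : ℝ) - (s : ℝ) + (d : ℝ) - 1) * ConicSurface.polar Z ξ t) ∧
    ((∀ j : ℕ, 1 ≤ j → j ≤ s - 1 → j ≤ n →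
        ¬ (1 ≤ -2 * (n : ℤ) - d + j + s + 2 ∧ -2 * (n : ℤ) - d + j + s + 2 ≤ j)) →
      Module.finrank ℝ (ConicSurface.spaceU d n s)
        = (n + d - 1).choose (d - 1) + (n + d - 2).choose (d - 1)) :=
  (mainTheorem9_general d n s hd).imp_right fun h _ => h
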